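/- Let $n\ge 1$. The alphabet is $[\overline n]=\{1<2<\dots<n<\overline n<\overline{n-1}<\dots<\overline 1\}$, with the involution $x\mapsto\overline x$ and with $|i|=|\overline{\imath}|=i$ for $1\le i\le n$. For $a\in[\overline n]$, $\prec_a$ denotes the circular order on $[\overline n]$ starting at $a$ (go around the circle $1,2,\dots,n,\overline n,\dots,\overline 1$ in increasing direction, beginning at $a$). Let $B_n$ be the group (under composition) of bijections $w:[\overline n]\to[\overline n]$ with $w(\overline x)=\overline{w(x)}$, and let $\ell(w)=\#\{(p,q)\in[n]\times[\overline n]: p\le|q|,\ w(p)>w(q)\}$. For $1\le i<j\le n$, write $(i,j)$ for the root $\varepsilon_i-\varepsilon_j$ and its reflection $t_{ij}t_{\overline{\jmath}\,\overline{\imath}}$, and $(i,\overline{\jmath})$ for the root $\varepsilon_i+\varepsilon_j$ and its reflection $t_{i\overline{\jmath}}t_{j\overline{\imath}}$; for $1\le i\le n$, write $(i,\overline{\imath})$ for the root $2\varepsilon_i$ and its reflection $t_{i\overline{\imath}}$. Here $t_{xy}$ is the transposition of $x$ and $y$; these roots are the positive roots of type $C_n$. Let $\rho=(n,n-1,\dots,1)$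 and $\langle\rho,\alpha^\vee\rangle=2(\rho,\alpha)/(\alpha,\alpha)$. The quantum Bruhat graph on $B_n$ has an edge $w\to ws_\alpha$ labeled by the positive root $\alpha$ whenever $\ell(ws_\alpha)=\ell(w)+1$ or $\ell(ws_\alpha)=\ell(w)-2\langle\rho,\alpha^\vee\rangle+1$. For $1\le k\le n$ let $\Gamma_l(k)=\Gamma_{k1}\Gamma_{k2}\cdots\Gamma_{kk}$ (concatenation), where $$\Gamma_{ki}=\big((1,\overline{\imath}),\dots,(i-1,\overline{\imath}),\ (i,\overline{k+1}),\dots,(i,\overline n),\ (i,\overline{\imath}),\ (i,n),(i,n-1),\dots,(i,k+1)\big),$$ and let $\mathrm{rev}(\Gamma_l(k))$ be the reversed sequence. A column of height $k$ is a sequence $C'=(C'(1),\dots,C'(k))$ of elements of $[\overline n]$ with pairwise distinct absolute values, in any order. For $w\in B_n$ let $w[1,k]=(w(1),\dots,w(k))$. Let $1\le k\le n$, let $u\in B_n$, let $C=u[1,k]$, and let $C'$ be a column of height $k$. Then the following hold. (1) There are a $v\in B_n$ with $v[1,k]=C'$ and a path $u=u_0,u_1,\dots,u_p=v$ in the quantum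 Bruhat graph whose sequence of edge labels is a subsequence of $\mathrm{rev}(\Gamma_l(k))$ if and only if the pair $C'C$ satisfies the following condition: for all $1\le i<l\le k$, neither $C(i)=C'(l)$ nor $C(i)\prec C'(l)\prec C'(i)$ holds, where $\prec$ is $\prec_{C(i)}$. (2) There is at most one such path: its endpoint $v$, its vertices and its edge labels are all uniquely determined by $u$ and $C'$. (3) For such a path and every $i=1,\dots,k$, $$C(i)=u_0(i)\preceq u_1(i)\preceq\cdots\preceq u_p(i)=C'(i),$$ where $\preceq$ is the weak version of $\prec_{C(i)}$. -/

import Mathlib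

namespace TypeC

/-- The alphabet `1 < 2 < ⋯ < n < n̄ < ⋯ < 2̄ < 1̄` with its linear order. The letter `i` is the
element `i - 1` of `Fin (2 * n)`, and `ī` is its mirror image `2 * n - i`. -/
abbrev Letter (n : ℕ) : Type := Fin (2 * n)

/-- The barring involution `x ↦ x̄`. -/
def bar {n : ℕ} (x : Letter n) : Letter n := Fin.rev x

/-- The unbarred letter with (zero-based) index `i`. -/
def unbarred {n : ℕ} (i : Fin n) : Letter n := ⟨i.val, by omega⟩

/-- The absolute value of a letter, as a zero-based index: both `i` and `ī` have index `i - 1`. -/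
def absIndex {n : ℕ} (x : Letter n) : Fin n :=
  ⟨min x.val (bar x).val, by
    have h := x.isLt
    simp only [bar, Fin.val_rev]
    omega⟩

/-- The hyperoctahedral group `B_n`: bijections `w` of the alphabet with `w(x̄) = \overline{w(x)}`.
The product is composition. -/
def signedPerm (n : ℕ) : Subgroup (Equiv.Perm (Letter n)) where
  carrier := {w | ∀ x, w (bar x) = bar (w x)}
  one_mem' := fun _ => rfl
  mul_mem' := by
    intro a b ha hb x
    simp only [Set.mem_ofPred_eq] at ha hb
    simp only [Equiv.Perm.mul_apply, hb, ha]
  inv_mem' := by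
    intro a ha x
    simp only [Set.mem_ofPred_eq] at ha
    rw [Equiv.Perm.inv_eq_iff_eq, ha]
    simp

/-- The length of `w`: the number of pairs of positions `(k, l) ∈ [n] × [n̄]` with `k ≤ |l|` and
`w(k) > w(l)`. -/
def length {n : ℕ} (w : signedPerm n) : ℕ :=
  (Finset.univ.filter fun p : Fin n × Letter n =>
    p.1 ≤ absIndex p.2 ∧ w.val p.2 < w.val (unbarred p.1)).card

/-- The positive roots of type `C_n`. -/
inductive PosRoot (n : ℕ) : Type
  /-- `(i, j)`, that is `ε_i - ε_j`, for `i < j` -/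
  | sub (i j : Fin n) (h : i < j) : PosRoot n
  /-- `(i, j̄)`, that is `ε_i + ε_j`, for `i < j` -/
  | add (i j : Fin n) (h : i < j) : PosRoot n
  /-- `(i, ī)`, that is `2 ε_i` -/
  | dbl (i : Fin n) : PosRoot n

namespace PosRoot

/-- The coordinates of a root in the basis `ε_1, …, ε_n`. -/
def toVec {n : ℕ} : PosRoot n → Fin n → ℚ
  | sub i j _ => Pi.single i 1 - Pi.single j 1
  | add i j _ => Pi.single i 1 + Pi.single j 1
  | dbl i => Pi.single i 2

/-- The underlying permutation of the alphabet of the reflection in a root. -/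
def reflPerm {n : ℕ} : PosRoot n → Equiv.Perm (Letter n)
  | sub i j _ =>
    Equiv.swap (unbarred i) (unbarred j) * Equiv.swap (bar (unbarred j)) (bar (unbarred i))
  | add i j _ =>
    Equiv.swap (unbarred i) (bar (unbarred j)) * Equiv.swap (unbarred j) (bar (unbarred i))
  | dbl i => Equiv.swap (unbarred i) (bar (unbarred i))

theorem reflPerm_mem {n : ℕ} (α : PosRoot n) : α.reflPerm ∈ signedPerm n := by
  intro x
  cases α with
  | sub i j h =>
    simp only [reflPerm, Equiv.Perm.mul_apply, Equiv.swap_apply_def, unbarred, bar, Fin.ext_iff,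
      Fin.val_rev, Fin.lt_def] at h ⊢
    grind
  | add i j h =>
    simp only [reflPerm, Equiv.Perm.mul_apply, Equiv.swap_apply_def, unbarred, bar, Fin.ext_iff,
      Fin.val_rev, Fin.lt_def] at h ⊢
    grind
  | dbl i =>
    simp only [reflPerm, Equiv.swap_apply_def, unbarred, bar, Fin.ext_iff, Fin.val_rev]
    grind

/-- The reflection `s_α`, as a signed permutation. -/
def refl {n : ℕ} (α : PosRoot n) : signedPerm n := ⟨α.reflPerm, α.reflPerm_mem⟩

end PosRoot

/-- The vector `ρ = (n, n - 1, …, 1)`. -/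
def rho (n : ℕ) (i : Fin n) : ℚ := (n : ℚ) - (i.val : ℚ)

/-- `⟨x, α^∨⟩ = 2 (x, α) / (α, α)`. -/
def corootPairing {n : ℕ} (x : Fin n → ℚ) (α : PosRoot n) : ℚ :=
  2 * (∑ i, x i * α.toVec i) / (∑ i, α.toVec i * α.toVec i)

/-- `QBEdge w α w'`: the quantum Bruhat graph has an edge `w → w'` labelled `α`, that is,
`w' = w s_α` and either `ℓ(w s_α) = ℓ(w) + 1` (Bruhat edge) or
`ℓ(w s_α) = ℓ(w) - 2⟨ρ, α^∨⟩ + 1` (quantum edge). -/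
def QBEdge {n : ℕ} (w : signedPerm n) (α : PosRoot n) (w' : signedPerm n) : Prop :=
  w' = w * α.refl ∧
    (length w' = length w + 1 ∨
      (length w' : ℚ) = (length w : ℚ) - 2 * corootPairing (rho n) α + 1)

/-- `IsQBPath u S v`: the list of labelled steps `S = [(α₁, u₁), …, (α_p, u_p)]` is a path
`u = u₀ → u₁ → ⋯ → u_p = v` in the quantum Bruhat graph, where the edge `u_{j-1} → u_j` is
labelled `α_j`. -/
def IsQBPath {n : ℕ} : signedPerm n → List (PosRoot n × signedPerm n) → signedPerm n → Prop
  | u, [], v => u = v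
  | u, (α, w) :: S, v => QBEdge u α w ∧ IsQBPath w S v

/-- The edge labels `α₁, …, α_p` of a path. -/
def pathLabels {n : ℕ} (S : List (PosRoot n × signedPerm n)) : List (PosRoot n) :=
  S.map Prod.fst

/-- The vertices `u₀, u₁, …, u_p` of a path starting at `u`. -/
def pathVertices {n : ℕ} (u : signedPerm n) (S : List (PosRoot n × signedPerm n)) :
    List (signedPerm n) :=
  u :: S.map Prod.snd

/-- The segment `Γ_{ki}`:
`(1, ī), …, (i-1, ī), (i, \overline{k+1}), …, (i, n̄), (i, ī), (i, n), (i, n-1), …, (i, k+1)`. -/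
def gammaSegment {n k : ℕ} (hk : k ≤ n) (i : Fin k) : List (PosRoot n) :=
  ((List.finRange n).filterMap fun a =>
      if h : a < Fin.castLE hk i then some (.add a (Fin.castLE hk i) h) else none) ++
  ((List.finRange n).filterMap fun m =>
      if h : k ≤ m.val then
        some (.add (Fin.castLE hk i) m (Fin.lt_def.2 (lt_of_lt_of_le i.isLt h)))
      else none) ++
  [.dbl (Fin.castLE hk i)] ++
  ((List.finRange n).reverse.filterMap fun m =>
      if h : k ≤ m.val then
        some (.sub (Fin.castLE hk i) m (Fin.lt_def.2 (lt_of_lt_of_le i.isLt h)))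
      else none)

/-- The chain of roots `Γ_l(k) = Γ_{k1} Γ_{k2} ⋯ Γ_{kk}`. -/
def gammaL {n k : ℕ} (hk : k ≤ n) : List (PosRoot n) :=
  (List.finRange k).flatMap fun i => gammaSegment hk i

/-- The strict circular order `x ≺_a y` on the alphabet starting at `a`. The subtraction is
modulo `2 * n`, so `x - a` is the number of steps needed to reach `x` from `a` when going around
the circle `1, …, n, n̄, …, 1̄` in the increasing direction. -/
def CircLT {n : ℕ} (a x y : Letter n) : Prop := x - a < y - a

/-- The weak circular order `x ⪯_a y` on the alphabet starting at `a`. -/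
def CircLE {n : ℕ} (a x y : Letter n) : Prop := x - a ≤ y - a

/-- A column of height `k`: a filling with letters of pairwise distinct absolute values, in any
order. -/
def IsColumn {n k : ℕ} (C : Fin k → Letter n) : Prop :=
  Function.Injective fun i => absIndex (C i)

/-- The column `w[1,k] = w(1) w(2) ⋯ w(k)`. -/
def initialColumn {n k : ℕ} (hk : k ≤ n) (w : signedPerm n) : Fin k → Letter n :=
  fun i => w.val (unbarred (Fin.castLE hk i))

/-- The matching condition on a pair of adjacent columns `C' C` of the same height: for `i < l`,
neither `C(i) = C'(l)` nor `C(i) ≺ C'(l) ≺ C'(i)` in the circular order starting at `C(i)`. -/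
def ColumnCondition {n k : ℕ} (C' C : Fin k → Letter n) : Prop :=
  ∀ i l : Fin k, i < l →
    ¬ (C i = C' l) ∧ ¬ (CircLT (C i) (C i) (C' l) ∧ CircLT (C i) (C' l) (C' i))

/-- `IsPathToColumn hk u C' v S`: `S` is a path from `u` to `v` in the quantum Bruhat graph such
that `v[1,k] = C'` and the edge labels form a subsequence of the reverse of `Γ_l(k)`. -/
def IsPathToColumn {n k : ℕ} (hk : k ≤ n) (u : signedPerm n) (C' : Fin k → Letter n)
    (v : signedPerm n) (S : List (PosRoot n × signedPerm n)) : Prop :=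
  IsQBPath u S v ∧ initialColumn hk v = C' ∧ (pathLabels S).Sublist (gammaL hk).reverse

end TypeC

/-! A signed permutation is recorded by its entries at the unbarred positions, numbers below `2 * n`
on which the bar acts as `x ↦ 2 * n - 1 - x`. For the roots `2ε_i` and `ε_i - ε_j`, Bruhat and
quantum edges are described by one circular statement: no entry at the relevant positions lies on
the arc from the old to the new value at `i` (`qbEdge_dbl_iff`, `qbEdge_sub_iff`). Edges labelled
`ε_i + ε_j` are never quantum; they raise the value at `i` within one sign (`qbEdge_add_iff`).

Existence, uniqueness and monotonicity all come from one greedy rule. The reversed chain treats the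
column positions `l` from the last to the first. The block of `l` brings the entry at `l` to its
target `c l` without touching the later column positions, and a reflection is applied exactly when
the value it brings to `l` lies on the half-open arc from the current entry to the target. Each root
is framed by two state predicates. The state after it determines which vertices reach it by staying
and which by stepping, and these two sets are disjoint (`Segment.single`). `Segment.append`
concatenates such statements, so the whole chain leads from the matching condition to equality with
the target.

The delicate steps are the long root and the roots `ε_i + ε_l` with `i < l`, which move two column
entries at once. Local arc conditions do not exclude overshooting a target there; the counting lemma
`entry_mem_of_target_mem` does. A symmetric set of letters that the later entries avoid, or have
already matched, cannot gain a target: positions with an entry in the set and positions with a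
target in it are equally many. -/

namespace TypeC

variable {n : ℕ}

/-! ### Entries of signed permutations and the action of reflections -/

/-- The value of `w` at the unbarred letter with index `j`, as a natural number. -/
def entry (w : signedPerm n) (j : Fin n) : ℕ := (w.val (unbarred j)).val

theorem bar_val (x : Letter n) : (bar x).val = 2 * n - 1 - x.val := by
  simp only [bar, Fin.val_rev]; omega

theorem bar_bar (x : Letter n) : bar (bar x) = x := Fin.rev_rev x

theorem bar_injective : Function.Injective (bar : Letter n → Letter n) := Fin.rev_injective

theorem entry_lt (w : signedPerm n) (j : Fin n) : entry w j < 2 * n := (w.val (unbarred j)).isLt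

theorem map_bar (w : signedPerm n) (x : Letter n) : w.val (bar x) = bar (w.val x) := w.property x

theorem unbarred_injective : Function.Injective (unbarred : Fin n → Letter n) := by
  intro i j h
  simpa [unbarred, Fin.ext_iff] using h

theorem unbarred_ne_bar (i j : Fin n) : unbarred i ≠ bar (unbarred j) := by
  intro h
  have := congrArg Fin.val h
  rw [bar_val] at this
  simp only [unbarred] at this
  omega

theorem entry_injective (w : signedPerm n) : Function.Injective (entry w) := fun _ _ h =>
  unbarred_injective (w.val.injective (Fin.ext h))

theorem entry_add_ne (w : signedPerm n) (i j : Fin n) : entry w i + entry w j + 1 ≠ 2 * n := by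
  intro h
  apply unbarred_ne_bar i j
  apply w.val.injective
  rw [map_bar]
  apply Fin.ext
  rw [bar_val]
  simp only [entry] at h
  omega

theorem eq_unbarred_or_bar (x : Letter n) : ∃ j : Fin n, x = unbarred j ∨ x = bar (unbarred j) := by
  by_cases h : x.val < n
  · exact ⟨⟨x.val, h⟩, Or.inl rfl⟩
  · refine ⟨⟨2 * n - 1 - x.val, by omega⟩, Or.inr (Fin.ext ?_)⟩
    rw [bar_val]
    simp only [unbarred]
    omega

theorem exists_entry (w : signedPerm n) (x : Letter n) :
    ∃ j, entry w j = x.val ∨ entry w j + x.val + 1 = 2 * n := by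
  obtain ⟨j, h | h⟩ := eq_unbarred_or_bar (w.val.symm x)
  · refine ⟨j, Or.inl ?_⟩
    rw [entry, ← h, Equiv.apply_symm_apply]
  · refine ⟨j, Or.inr ?_⟩
    have h2 : x = bar (w.val (unbarred j)) := by
      rw [← map_bar, ← h, Equiv.apply_symm_apply]
    have h3 := congrArg Fin.val h2
    rw [bar_val] at h3
    have := entry_lt w j
    simp only [entry] at *
    omega

theorem entry_mul_refl_sub (w : signedPerm n) (i j : Fin n) (h : i < j) (z : Fin n) :
    entry (w * (PosRoot.sub i j h).refl) z =
      if z = i then entry w j else if z = j then entry w i else entry w z := by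
  have h1 : (PosRoot.sub i j h).reflPerm (unbarred z) =
      unbarred (if z = i then j else if z = j then i else z) := by
    simp only [PosRoot.reflPerm, Equiv.Perm.mul_apply, Equiv.swap_apply_def,
      unbarred_ne_bar, if_false, unbarred_injective.eq_iff]
    split_ifs <;> rfl
  simp only [entry, PosRoot.refl, Subgroup.coe_mul, Equiv.Perm.mul_apply, h1]
  split_ifs <;> rfl

theorem entry_mul_refl_add (w : signedPerm n) (i j : Fin n) (h : i < j) (z : Fin n) :
    entry (w * (PosRoot.add i j h).refl) z =
      if z = i then 2 * n - 1 - entry w j else if z = j then 2 * n - 1 - entry w i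
      else entry w z := by
  have h1 : (PosRoot.add i j h).reflPerm (unbarred z) =
      if z = i then bar (unbarred j) else if z = j then bar (unbarred i) else unbarred z := by
    have := h.ne
    simp only [PosRoot.reflPerm, Equiv.Perm.mul_apply, Equiv.swap_apply_def,
      unbarred_ne_bar, if_false, unbarred_injective.eq_iff]
    have h2 (a b : Fin n) : bar (unbarred a) ≠ unbarred b := (unbarred_ne_bar b a).symm
    split_ifs <;> simp_all [unbarred_ne_bar, unbarred_injective.eq_iff, bar_injective.eq_iff]
  simp only [entry, PosRoot.refl, Subgroup.coe_mul, Equiv.Perm.mul_apply, h1]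
  split_ifs <;> simp only [map_bar, bar_val]

theorem entry_mul_refl_dbl (w : signedPerm n) (i z : Fin n) :
    entry (w * (PosRoot.dbl i).refl) z =
      if z = i then 2 * n - 1 - entry w i else entry w z := by
  have h1 : (PosRoot.dbl i).reflPerm (unbarred z) =
      if z = i then bar (unbarred i) else unbarred z := by
    simp only [PosRoot.reflPerm, Equiv.swap_apply_def,
      unbarred_ne_bar, if_false, unbarred_injective.eq_iff]
  simp only [entry, PosRoot.refl, Subgroup.coe_mul, Equiv.Perm.mul_apply, h1]
  split_ifs <;> simp only [map_bar, bar_val]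

/-! ### Length as a sum over pairs of positions, and its change -/

/-- The contribution to the length of a pair of positions `p`, `q` with entries `a`, `b`. -/
def pairLength (N p q a b : ℕ) : ℤ :=
  if p < q then (if b < a then 1 else 0) + (if N ≤ a + b then 1 else 0) else 0

theorem sum_letter {M : Type*} [AddCommMonoid M] (F : Letter n → M) :
    ∑ x, F x = ∑ j : Fin n, F (unbarred j) + ∑ j : Fin n, F (bar (unbarred j)) := by
  have h : n + n = 2 * n := by omega
  rw [← (finCongr h).sum_comp, Fin.sum_univ_add]
  congr 1
  rw [← Equiv.sum_comp Fin.revPerm]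
  apply Finset.sum_congr rfl
  intro j _
  congr 1
  apply Fin.ext
  rw [bar_val]
  simp [unbarred]
  omega

theorem absIndex_unbarred (j : Fin n) : absIndex (unbarred j) = j := by
  apply Fin.ext
  simp only [absIndex, bar_val, unbarred]
  omega

theorem absIndex_bar (x : Letter n) : absIndex (bar x) = absIndex x := by
  apply Fin.ext
  simp only [absIndex, bar_bar]
  exact min_comm _ _

theorem length_eq_sum (w : signedPerm n) :
    (length w : ℤ) = ∑ p : Fin n, ∑ q : Fin n, pairLength (2 * n) p q (entry w p) (entry w q) +
      ∑ p, (if n ≤ entry w p then 1 else 0 : ℤ) := by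
  rw [length, Finset.card_filter, Nat.cast_sum, Fintype.sum_prod_type, ← Finset.sum_add_distrib]
  apply Finset.sum_congr rfl
  intro p _
  -- The sign term is the diagonal contribution `q = p`; written as a sum over `q`, it allows a
  -- termwise comparison.
  have h1 : (if n ≤ entry w p then 1 else 0 : ℤ) =
      ∑ q, if q = p then (if n ≤ entry w p then 1 else 0 : ℤ) else 0 := by simp
  rw [sum_letter, h1, ← Finset.sum_add_distrib, ← Finset.sum_add_distrib]
  apply Finset.sum_congr rfl
  intro q _
  have h2 := entry_lt w p
  have h3 := entry_lt w q
  simp only [absIndex_bar, absIndex_unbarred, map_bar, Fin.lt_def, bar_val, pairLength, Fin.ext_iff,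
    Fin.le_def]
  change (((if p.val ≤ q.val ∧ entry w q < entry w p then 1 else 0 : ℕ) : ℤ) +
    ((if p.val ≤ q.val ∧ 2 * n - 1 - entry w q < entry w p then 1 else 0 : ℕ) : ℤ)) = _
  by_cases hpq : p = q
  · subst hpq
    simp only [le_refl, lt_irrefl, true_and, if_false, if_true]
    split_ifs <;> simp <;> omega
  · have : p.val ≠ q.val := fun h => hpq (Fin.ext h)
    push_cast
    split_ifs <;> first | rfl | omega

/-- `z` lies in the closed circular arc from `a` to `b`. -/
def Arc (a b z : ℕ) : Prop := (a ≤ b ∧ a ≤ z ∧ z ≤ b) ∨ (b < a ∧ (a ≤ z ∨ z ≤ b))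

/-- Applied to the change of pair contributions under a reflection, which vanishes unless a moved
position is involved. -/
theorem sum_sum_eq_of_support_singleton (D : Fin n → Fin n → ℤ) (i : Fin n)
    (h : ∀ p q, p ≠ i → q ≠ i → D p q = 0) :
    ∑ p, ∑ q, D p q = D i i + ∑ z, if z ≠ i then D i z + D z i else 0 := by
  have h1 (p : Fin n) (hp : p ≠ i) : ∑ q, D p q = D p i :=
    Finset.sum_eq_single i (fun q _ hq => h p q hp hq) (by simp)
  rw [← Finset.sum_filter, Finset.filter_ne', Finset.sum_add_distrib, ← add_assoc,
    Finset.add_sum_erase _ _ (Finset.mem_univ i), ← Finset.add_sum_erase _ _ (Finset.mem_univ i)]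
  congr 1
  exact Finset.sum_congr rfl fun p hp => h1 p (Finset.ne_of_mem_erase hp)

theorem sum_sum_eq_of_support_pair (D : Fin n → Fin n → ℤ) (i j : Fin n) (hij : i ≠ j)
    (h : ∀ p q, p ≠ i → p ≠ j → q ≠ i → q ≠ j → D p q = 0) :
    ∑ p, ∑ q, D p q = D i i + D j j + D i j + D j i +
      ∑ z, if z ≠ i ∧ z ≠ j then D i z + D z i + D j z + D z j else 0 := by
  -- The matrix is split into its row and column `j` and the rest, so that the one-index formula
  -- applies to each part.
  have key := sum_sum_eq_of_support_singleton
    (fun p q => if p = j ∨ q = j then 0 else D p q) i (by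
      intro p q hp hq
      by_cases hpj : p = j ∨ q = j
      · simp [hpj]
      · rw [not_or] at hpj
        simp [hpj, h p q hp hpj.1 hq hpj.2])
  have key2 := sum_sum_eq_of_support_singleton
    (fun p q => if p = j ∨ q = j then D p q else 0) j (by
      intro p q hp hq
      simp [hp, hq])
  have split : ∑ p, ∑ q, D p q = ∑ p, ∑ q, (if p = j ∨ q = j then 0 else D p q) +
      ∑ p, ∑ q, (if p = j ∨ q = j then D p q else 0) := by
    rw [← Finset.sum_add_distrib]
    refine Finset.sum_congr rfl fun p _ => ?_
    rw [← Finset.sum_add_distrib]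
    refine Finset.sum_congr rfl fun q _ => ?_
    split_ifs <;> simp
  have single : ∑ z, (if z = i then D j i + D i j else 0) = D j i + D i j := by simp
  rw [split, key, key2]
  have comb : (∑ z, if z ≠ i then (if i = j ∨ z = j then 0 else D i z) +
      (if z = j ∨ i = j then 0 else D z i) else 0) +
      (∑ z, if z ≠ j then (if j = j ∨ z = j then D j z else 0) +
        (if z = j ∨ j = j then D z j else 0) else 0) =
      ∑ z, (if z = i then D j i + D i j else 0) +
      ∑ z, if z ≠ i ∧ z ≠ j then D i z + D z i + D j z + D z j else 0 := by
    rw [← Finset.sum_add_distrib, ← Finset.sum_add_distrib]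
    refine Finset.sum_congr rfl fun z _ => ?_
    by_cases h1 : z = i
    · subst h1; simp [hij]
    · by_cases h2 : z = j
      · subst h2; simp [h1]
      · simp [h1, h2, hij]; ring
  rw [single] at comb
  simp only [hij, true_or, if_true, or_self, if_false] at comb ⊢
  linarith

theorem sum_ite_eq_zero_iff (P : Fin n → Prop) [DecidablePred P] :
    (∑ z, if P z then 1 else 0 : ℤ) = 0 ↔ ∀ z, ¬ P z := by
  rw [Finset.sum_eq_zero_iff_of_nonneg (by intro z _; split_ifs <;> simp)]
  simp

theorem sum_ite_and_eq_card_iff (P Q : Fin n → Prop) [DecidablePred P] [DecidablePred Q] :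
    (∑ z, if P z ∧ Q z then 1 else 0 : ℤ) = ∑ z, (if P z then 1 else 0 : ℤ) ↔ ∀ z, P z → Q z := by
  rw [Finset.sum_eq_sum_iff_of_le (by intro z _; split_ifs <;> simp_all)]
  simp only [Finset.mem_univ, true_imp_iff]
  refine forall_congr' fun z => ?_
  split_ifs <;> simp_all

theorem length_sub_length (w w' : signedPerm n) :
    (length w' : ℤ) - length w = ∑ p : Fin n, ∑ q : Fin n,
      (pairLength (2 * n) p q (entry w' p) (entry w' q) -
      pairLength (2 * n) p q (entry w p) (entry w q)) +
      ∑ p, ((if n ≤ entry w' p then 1 else 0) - (if n ≤ entry w p then 1 else 0) : ℤ) := by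
  rw [length_eq_sum, length_eq_sum]
  simp only [Finset.sum_sub_distrib]
  ring

/-! ### Edge criteria for the three kinds of roots -/

theorem corootPairing_dbl (i : Fin n) :
    corootPairing (rho n) (.dbl i) = (((n : ℤ) - (i.val : ℤ) : ℤ) : ℚ) := by
  have h1 : ∑ z, rho n z * (PosRoot.dbl i).toVec z = rho n i * 2 := by
    simp [PosRoot.toVec, Pi.single_apply]
  have h2 : ∑ z, (PosRoot.dbl i).toVec z * (PosRoot.dbl i).toVec z = 4 := by
    simp [PosRoot.toVec, Pi.single_apply]; norm_num
  rw [corootPairing, h1, h2, rho]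
  push_cast; ring

theorem corootPairing_sub (i j : Fin n) (h : i < j) :
    corootPairing (rho n) (.sub i j h) = (((j.val : ℤ) - (i.val : ℤ) : ℤ) : ℚ) := by
  have h1 : ∑ z, rho n z * (PosRoot.sub i j h).toVec z = rho n i - rho n j := by
    simp [PosRoot.toVec, Pi.single_apply, mul_sub]
  have h2 : ∑ z, (PosRoot.sub i j h).toVec z * (PosRoot.sub i j h).toVec z = 2 := by
    simp [PosRoot.toVec, Pi.single_apply, mul_sub, h.ne, h.ne']; norm_num
  rw [corootPairing, h1, h2, rho, rho]
  push_cast; ring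

theorem corootPairing_add (i j : Fin n) (h : i < j) :
    corootPairing (rho n) (.add i j h) =
      ((2 * (n : ℤ) - (j.val : ℤ) - (i.val : ℤ) : ℤ) : ℚ) := by
  have h1 : ∑ z, rho n z * (PosRoot.add i j h).toVec z = rho n i + rho n j := by
    simp [PosRoot.toVec, Pi.single_apply, mul_add, Finset.sum_add_distrib]
  have h2 : ∑ z, (PosRoot.add i j h).toVec z * (PosRoot.add i j h).toVec z = 2 := by
    simp [PosRoot.toVec, Pi.single_apply, mul_add, Finset.sum_add_distrib, h.ne, h.ne']; norm_num
  rw [corootPairing, h1, h2, rho, rho]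
  push_cast; ring

theorem qbEdge_mul_refl_iff (w : signedPerm n) (α : PosRoot n) (m : ℤ)
    (hm : corootPairing (rho n) α = (m : ℚ)) :
    QBEdge w α (w * α.refl) ↔ ((length (w * α.refl) : ℤ) - length w = 1 ∨
      (length (w * α.refl) : ℤ) - length w = 1 - 2 * m) := by
  rw [QBEdge, hm]
  simp only [true_and]
  refine or_congr (by omega) ?_
  constructor
  · intro h
    have : ((length (w * α.refl) : ℤ) : ℚ) = ((length w - 2 * m + 1 : ℤ) : ℚ) := by
      push_cast; exact h
    have := Int.cast_injective this
    omega
  · intro h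
    have h2 : (length (w * α.refl) : ℤ) = length w - 2 * m + 1 := by omega
    have := congrArg (Int.cast : ℤ → ℚ) h2
    push_cast at this
    exact this

theorem sum_ite_Ioi (i : Fin n) : (∑ z, if i < z then 1 else 0 : ℤ) = n - 1 - i.val := by
  rw [Finset.sum_boole, Finset.filter_lt_eq_Ioi, Fin.card_Ioi]
  have := i.isLt
  push_cast [Nat.cast_sub, Nat.sub_sub]
  omega

theorem sum_ite_Ioo (i j : Fin n) (h : i < j) :
    (∑ z, if i < z ∧ z < j then 1 else 0 : ℤ) = j.val - i.val - 1 := by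
  have : (Finset.univ.filter fun z => i < z ∧ z < j) = Finset.Ioo i j := by ext; simp
  rw [Finset.sum_boole, this, Fin.card_Ioo]
  rw [Fin.lt_def] at h
  omega

theorem sum_ite_Ioi_ne (i j : Fin n) (h : i < j) :
    (∑ z, if i < z ∧ z ≠ j then 1 else 0 : ℤ) = n - 2 - i.val := by
  have : ∀ z, (if i < z ∧ z ≠ j then 1 else 0 : ℤ) =
      (if i < z then 1 else 0) - if z = j then 1 else 0 := by
    intro z
    by_cases hzj : z = j
    · simp [hzj, h]
    · simp [hzj]
  rw [Finset.sum_congr rfl fun z _ => this z, Finset.sum_sub_distrib, sum_ite_Ioi,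
    Finset.sum_ite_eq' Finset.univ j, if_pos (Finset.mem_univ j)]
  ring

theorem sum_ite_nonneg (P : Fin n → Prop) [DecidablePred P] :
    0 ≤ (∑ z, if P z then 1 else 0 : ℤ) :=
  Finset.sum_nonneg fun z _ => by split_ifs <;> simp

theorem sum_ite_and_le (P Q : Fin n → Prop) [DecidablePred P] [DecidablePred Q] :
    (∑ z, if P z ∧ Q z then 1 else 0 : ℤ) ≤ ∑ z, if P z then 1 else 0 :=
  Finset.sum_le_sum fun z _ => by split_ifs <;> simp_all

/-- Going up, the length grows by one exactly when no candidate lies in between. Going down, the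
quantum drop is the largest possible one and requires all candidates to lie in between, that is,
none on the complementary arc. Both cases are the same circular condition. -/
theorem signed_count_iff (P Q : Fin n → Prop) [DecidablePred P] [DecidablePred Q] (up : Prop)
    [Decidable up] (d m : ℤ)
    (hd : d = (if up then 1 else -1) * (1 + 2 * ∑ z, if P z ∧ Q z then 1 else 0 : ℤ))
    (hm : m = 1 + ∑ z, if P z then 1 else 0) :
    (d = 1 ∨ d = 1 - 2 * m) ↔ (∀ z, P z → (¬ Q z ↔ up)) := by
  have h0 := sum_ite_nonneg fun z => P z ∧ Q z
  have h1 := sum_ite_nonneg P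
  by_cases hup : up
  · simp only [hup, if_true, one_mul, iff_true] at hd ⊢
    have := sum_ite_eq_zero_iff fun z => P z ∧ Q z
    simp only [not_and] at this
    rw [← this]
    omega
  · simp only [hup, if_false, iff_false, not_not] at hd ⊢
    rw [← sum_ite_and_eq_card_iff P Q]
    omega

/-- `z` lies strictly between `a` and `b` in the linear order. -/
def Between (a b z : ℕ) : Prop := (a < z ∧ z < b) ∨ (b < z ∧ z < a)

instance (a b z : ℕ) : Decidable (Between a b z) := by unfold Between; infer_instance

theorem pairLength_self (N p a b : ℕ) : pairLength N p p a b = 0 := by simp [pairLength]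

/-- For `z < i`, barring the entry at `i` merely exchanges the two comparisons counted for the pair;
only `z > i` matters, and there both comparisons change together. -/
theorem pairLength_change_dbl (n i z a b : ℕ) (hz : z ≠ i) (ha : a < 2 * n) (h1 : b ≠ a)
    (h2 : a + b + 1 ≠ 2 * n) :
    pairLength (2 * n) i z (2 * n - 1 - a) b - pairLength (2 * n) i z a b +
        (pairLength (2 * n) z i b (2 * n - 1 - a) - pairLength (2 * n) z i b a) =
      (if a < n then 1 else -1) * 2 * (if i < z ∧ Between a (2 * n - 1 - a) b then 1 else 0) := by
  rcases lt_or_gt_of_ne hz with h | h <;>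
    simp only [pairLength, h, h.not_gt, if_true, if_false, Between, true_and, false_and] <;>
    by_cases hs : a < n <;> simp only [hs, if_true, if_false] <;> omega

theorem pairLength_change_sub (n i j z a b c : ℕ) (hij : i < j) (hz : z ≠ i) (hz' : z ≠ j)
    (h1 : c ≠ a) (h2 : c ≠ b) (h3 : a ≠ b) :
    pairLength (2 * n) i z b c - pairLength (2 * n) i z a c +
        (pairLength (2 * n) z i c b - pairLength (2 * n) z i c a) +
        (pairLength (2 * n) j z a c - pairLength (2 * n) j z b c) +
        (pairLength (2 * n) z j c a - pairLength (2 * n) z j c b) =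
      (if a < b then 1 else -1) * 2 *
        (if (i < z ∧ z < j) ∧ Between a b c then 1 else 0) := by
  rcases lt_or_gt_of_ne hz with h | h <;> rcases lt_or_gt_of_ne hz' with h' | h' <;>
    simp only [pairLength, h, h', h.not_gt, h'.not_gt, if_true, if_false, Between, true_and,
      false_and, and_true] <;>
    by_cases hs : a < b <;> simp only [hs, if_true, if_false] <;> omega

set_option maxHeartbeats 1000000 in
-- Positions before `i` cancel. Between `i` and `j` only the letter `c` itself is compared with the
-- moving value; beyond `j` its bar is counted as well.
theorem pairLength_change_add (n i j z a b c : ℕ) (hij : i < j) (hz : z ≠ i) (hz' : z ≠ j)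
    (h1 : c ≠ a) (h2 : c ≠ b) (h3 : a ≠ b) (ha : a < 2 * n) (hb : b < 2 * n) (hc : c < 2 * n)
    (h1' : a + c + 1 ≠ 2 * n) (h2' : b + c + 1 ≠ 2 * n) (h3' : a + b + 1 ≠ 2 * n) :
    pairLength (2 * n) i z (2 * n - 1 - b) c - pairLength (2 * n) i z a c +
        (pairLength (2 * n) z i c (2 * n - 1 - b) - pairLength (2 * n) z i c a) +
        (pairLength (2 * n) j z (2 * n - 1 - a) c - pairLength (2 * n) j z b c) +
        (pairLength (2 * n) z j c (2 * n - 1 - a) - pairLength (2 * n) z j c b) =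
      (if a < 2 * n - 1 - b then 1 else -1) * 2 *
        ((if i < z ∧ Between a (2 * n - 1 - b) c then 1 else 0) +
          (if j < z ∧ Between a (2 * n - 1 - b) (2 * n - 1 - c) then 1 else 0)) := by
  -- Mirror images become variables tied by additive equations, which removes truncated subtraction
  -- before the case split.
  obtain ⟨A, hA⟩ : ∃ A, A = 2 * n - 1 - a := ⟨_, rfl⟩
  obtain ⟨B, hB⟩ : ∃ B, B = 2 * n - 1 - b := ⟨_, rfl⟩
  obtain ⟨C, hC⟩ : ∃ C, C = 2 * n - 1 - c := ⟨_, rfl⟩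
  rw [← hA, ← hB, ← hC]
  have hA' : A + a + 1 = 2 * n := by omega
  have hB' : B + b + 1 = 2 * n := by omega
  have hC' : C + c + 1 = 2 * n := by omega
  clear hA hB hC
  rcases lt_or_gt_of_ne hz with h | h <;> rcases lt_or_gt_of_ne hz' with h' | h' <;>
    simp only [pairLength, h, h', h.not_gt, h'.not_gt, if_true, if_false, Between, true_and,
      false_and] <;>
    by_cases hs : a < B <;> simp only [hs, if_true, if_false] <;> omega

/-- An edge labelled by a long root. -/
theorem qbEdge_dbl_iff (w : signedPerm n) (i : Fin n) :
    QBEdge w (.dbl i) (w * (PosRoot.dbl i).refl) ↔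
      ∀ z, i < z → ¬ Arc (entry w i) (2 * n - 1 - entry w i) (entry w z) := by
  rw [qbEdge_mul_refl_iff w _ _ (corootPairing_dbl i)]
  have hlt := entry_lt w
  have hadd := entry_add_ne w
  have hne : ∀ z, z ≠ i → entry w z ≠ entry w i := fun z hz h => hz (entry_injective w h)
  obtain ⟨w', hw'⟩ : ∃ w', w' = w * (PosRoot.dbl i).refl := ⟨_, rfl⟩
  rw [← hw']
  have hi : entry w' i = 2 * n - 1 - entry w i := by simp [hw', entry_mul_refl_dbl]
  have hz (z : Fin n) (h : z ≠ i) : entry w' z = entry w z := by simp [hw', entry_mul_refl_dbl, h]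
  have hs : ∑ p, ((if n ≤ entry w' p then 1 else 0) - (if n ≤ entry w p then 1 else 0) : ℤ) =
      if entry w i < n then 1 else -1 := by
    rw [Finset.sum_eq_single i]
    · rw [hi]
      have := hlt i
      split_ifs <;> omega
    · intro z _ h; rw [hz z h]; simp
    · simp
  have hd := length_sub_length w w'
  rw [hs, sum_sum_eq_of_support_singleton _ i
    (by intro p q hp hq; simp [hz p hp, hz q hq])] at hd
  rw [signed_count_iff (fun z => i < z)
    (fun z => Between (entry w i) (2 * n - 1 - entry w i) (entry w z)) (entry w i < n)
    _ _ ?_ (by rw [sum_ite_Ioi]; ring)]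
  · refine forall_congr' fun z => imp_congr_right fun hiz => ?_
    have := hne z hiz.ne'
    have := hlt i
    have := hlt z
    have := hadd i z
    simp only [Arc, Between]
    omega
  · rw [hd, mul_add, mul_one, add_comm, ← mul_assoc, Finset.mul_sum]
    simp only [pairLength_self, sub_zero, zero_add]
    congr 1
    refine Finset.sum_congr rfl fun z _ => ?_
    by_cases hzi : z = i
    · simp [hzi]
    · rw [if_pos hzi, hi, hz z hzi]
      exact pairLength_change_dbl n i z _ _ (fun h => hzi (Fin.ext h)) (hlt i) (hne z hzi)
        (hadd i z)

/-- An edge labelled by a root `ε_i - ε_j`. -/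
theorem qbEdge_sub_iff (w : signedPerm n) (i j : Fin n) (h : i < j) :
    QBEdge w (.sub i j h) (w * (PosRoot.sub i j h).refl) ↔
      ∀ z, i < z → z < j → ¬ Arc (entry w i) (entry w j) (entry w z) := by
  rw [qbEdge_mul_refl_iff w _ _ (corootPairing_sub i j h)]
  have hne : ∀ y z, z ≠ y → entry w z ≠ entry w y := fun y z hz h => hz (entry_injective w h)
  obtain ⟨w', hw'⟩ : ∃ w', w' = w * (PosRoot.sub i j h).refl := ⟨_, rfl⟩
  rw [← hw']
  have hi : entry w' i = entry w j := by simp [hw', entry_mul_refl_sub]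
  have hj : entry w' j = entry w i := by simp [hw', entry_mul_refl_sub, h.ne']
  have hz (z : Fin n) (h1 : z ≠ i) (h2 : z ≠ j) : entry w' z = entry w z := by
    simp [hw', entry_mul_refl_sub, h1, h2]
  have hs : ∑ p, ((if n ≤ entry w' p then 1 else 0) - (if n ≤ entry w p then 1 else 0) : ℤ) =
      0 := by
    rw [Finset.sum_eq_add i j h.ne]
    · rw [hi, hj]; ring
    · intro z _ h; rw [hz z h.1 h.2]; simp
    · simp
    · simp
  have hd := length_sub_length w w'
  rw [hs, sum_sum_eq_of_support_pair _ i j h.ne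
    (by intro p q hp hp' hq hq'; simp [hz p hp hp', hz q hq hq'])] at hd
  rw [signed_count_iff (fun z => i < z ∧ z < j)
    (fun z => Between (entry w i) (entry w j) (entry w z)) (entry w i < entry w j)
    _ _ ?_ (by rw [sum_ite_Ioo i j h]; ring)]
  · refine forall_congr' fun z => ?_
    rw [and_imp]
    refine imp_congr_right fun hiz => imp_congr_right fun hzj => ?_
    have := hne i z hiz.ne'
    have := hne j z hzj.ne
    have := hne i j h.ne'
    simp only [Arc, Between]
    omega
  · have hij : pairLength (2 * n) i j (entry w j) (entry w i) -
        pairLength (2 * n) i j (entry w i) (entry w j) +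
        (pairLength (2 * n) j i (entry w i) (entry w j) -
        pairLength (2 * n) j i (entry w j) (entry w i)) =
        if entry w i < entry w j then 1 else -1 := by
      have := hne i j h.ne'
      have h' : i.val < j.val := h
      simp only [pairLength, h', h'.not_gt, if_true, if_false]
      omega
    rw [hd, mul_add, mul_one, ← mul_assoc, Finset.mul_sum, hi, hj, pairLength_self,
      pairLength_self, pairLength_self, pairLength_self, sub_zero, add_zero, zero_add, zero_add, hij]
    congr 1
    refine Finset.sum_congr rfl fun z _ => ?_
    by_cases hzi : z = i
    · simp [hzi]
    by_cases hzj : z = j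
    · simp [hzj]
    rw [if_pos ⟨hzi, hzj⟩, hz z hzi hzj]
    exact pairLength_change_sub n i j z _ _ _ h (fun h => hzi (Fin.ext h))
      (fun h => hzj (Fin.ext h)) (hne i z hzi) (hne j z hzj) (hne j i h.ne)

/-- The sign correction is `0` within one sign and otherwise `±2` in the direction of the move, so
`d = 1` forces a rise within one sign with `N = 0`. The quantum value would need `N` to be at least
`2n - 2 - i - j`, one more than the bound `h1` allows. -/
theorem add_count_iff (n i j a b : ℕ) (N d : ℤ) (hij : i < j) (hj : j < n) (ha : a < 2 * n)
    (hb : b < 2 * n) (h0 : 0 ≤ N)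
    (h1 : N ≤ (n : ℤ) - 2 - i + (n - 1 - j))
    (hd : d = (if a < 2 * n - 1 - b then 1 else -1) +
      (if a < 2 * n - 1 - b then 1 else -1) * 2 * N +
      (((if n ≤ 2 * n - 1 - b then 1 else 0) - (if n ≤ a then 1 else 0)) +
      ((if n ≤ 2 * n - 1 - a then 1 else 0) - (if n ≤ b then 1 else 0)))) :
    (d = 1 ∨ d = 1 - 2 * (2 * (n : ℤ) - j - i)) ↔
      a < 2 * n - 1 - b ∧ (2 * n - 1 - b < n ∨ n ≤ a) ∧ N = 0 := by
  have e1 : n ≤ 2 * n - 1 - a ↔ ¬ n ≤ a := by omega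
  have e2 : n ≤ 2 * n - 1 - b ↔ ¬ n ≤ b := by omega
  by_cases hs : a < 2 * n - 1 - b <;>
    by_cases hi : n ≤ a <;> by_cases hj : n ≤ b <;>
      simp only [hs, e1, e2, hi, hj, if_true, if_false, true_and, false_and, not_true,
        not_false_iff, or_true, or_false, iff_false] at hd ⊢ <;> omega

/-- An edge labelled by a root `ε_i + ε_j`. -/
theorem qbEdge_add_iff (w : signedPerm n) (i j : Fin n) (h : i < j) :
    QBEdge w (.add i j h) (w * (PosRoot.add i j h).refl) ↔
      entry w i < 2 * n - 1 - entry w j ∧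
      (2 * n - 1 - entry w j < n ∨ n ≤ entry w i) ∧
      (∀ z, i < z → ¬ Between (entry w i) (2 * n - 1 - entry w j) (entry w z)) ∧
      (∀ z, j < z → ¬ Between (entry w i) (2 * n - 1 - entry w j) (2 * n - 1 - entry w z)) := by
  rw [qbEdge_mul_refl_iff w _ _ (corootPairing_add i j h)]
  have hlt := entry_lt w
  have hadd := entry_add_ne w
  have hne : ∀ y z, z ≠ y → entry w z ≠ entry w y := fun y z hz h => hz (entry_injective w h)
  obtain ⟨w', hw'⟩ : ∃ w', w' = w * (PosRoot.add i j h).refl := ⟨_, rfl⟩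
  rw [← hw']
  have hi : entry w' i = 2 * n - 1 - entry w j := by simp [hw', entry_mul_refl_add]
  have hj : entry w' j = 2 * n - 1 - entry w i := by simp [hw', entry_mul_refl_add, h.ne']
  have hz (z : Fin n) (h1 : z ≠ i) (h2 : z ≠ j) : entry w' z = entry w z := by
    simp [hw', entry_mul_refl_add, h1, h2]
  have hs : ∑ p, ((if n ≤ entry w' p then 1 else 0) - (if n ≤ entry w p then 1 else 0) : ℤ) =
      ((if n ≤ 2 * n - 1 - entry w j then 1 else 0) - (if n ≤ entry w i then 1 else 0)) +
      ((if n ≤ 2 * n - 1 - entry w i then 1 else 0) - (if n ≤ entry w j then 1 else 0)) := by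
    rw [Finset.sum_eq_add i j h.ne]
    · rw [hi, hj]
    · intro z _ h; rw [hz z h.1 h.2]; simp
    · simp
    · simp
  have hd := length_sub_length w w'
  rw [hs, sum_sum_eq_of_support_pair _ i j h.ne
    (by intro p q hp hp' hq hq'; simp [hz p hp hp', hz q hq hq']), hi, hj] at hd
  have hsum : (∑ z, if z ≠ i ∧ z ≠ j then
      pairLength (2 * n) i z (2 * n - 1 - entry w j) (entry w' z) -
        pairLength (2 * n) i z (entry w i) (entry w z) +
      (pairLength (2 * n) z i (entry w' z) (2 * n - 1 - entry w j) -
        pairLength (2 * n) z i (entry w z) (entry w i)) +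
      (pairLength (2 * n) j z (2 * n - 1 - entry w i) (entry w' z) -
        pairLength (2 * n) j z (entry w j) (entry w z)) +
      (pairLength (2 * n) z j (entry w' z) (2 * n - 1 - entry w i) -
        pairLength (2 * n) z j (entry w z) (entry w j)) else 0) =
      (if entry w i < 2 * n - 1 - entry w j then 1 else -1) * 2 *
      (∑ z, (if (i < z ∧ z ≠ j) ∧ Between (entry w i) (2 * n - 1 - entry w j) (entry w z)
        then 1 else 0) +
       ∑ z, (if j < z ∧ Between (entry w i) (2 * n - 1 - entry w j) (2 * n - 1 - entry w z)
        then 1 else 0)) := by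
    rw [← Finset.sum_add_distrib, Finset.mul_sum]
    refine Finset.sum_congr rfl fun z _ => ?_
    by_cases hzi : z = i
    · simp [hzi, h.not_gt]
    by_cases hzj : z = j
    · simp [hzj]
    rw [if_pos ⟨hzi, hzj⟩, hz z hzi hzj]
    simp only [ne_eq, hzj, not_false_eq_true, and_true]
    exact pairLength_change_add n i j z _ _ _ h (fun h => hzi (Fin.ext h))
      (fun h => hzj (Fin.ext h)) (hne i z hzi) (hne j z hzj) (hne j i h.ne) (hlt i) (hlt j) (hlt z)
      (hadd i z) (hadd j z) (hadd i j)
  rw [hsum] at hd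
  have hij : pairLength (2 * n) i j (2 * n - 1 - entry w j) (2 * n - 1 - entry w i) -
      pairLength (2 * n) i j (entry w i) (entry w j) +
      (pairLength (2 * n) j i (2 * n - 1 - entry w i) (2 * n - 1 - entry w j) -
      pairLength (2 * n) j i (entry w j) (entry w i)) =
      if entry w i < 2 * n - 1 - entry w j then 1 else -1 := by
    have := hne i j h.ne'
    have := hlt i
    have := hlt j
    have := hadd i j
    have h' : i.val < j.val := h
    simp only [pairLength, h', h'.not_gt, if_true, if_false]
    omega
  rw [pairLength_self, pairLength_self, pairLength_self, pairLength_self, sub_zero, add_zero,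
    zero_add, hij] at hd
  have h1 := sum_ite_eq_zero_iff fun z => (i < z ∧ z ≠ j) ∧
    Between (entry w i) (2 * n - 1 - entry w j) (entry w z)
  have h2 := sum_ite_eq_zero_iff fun z => j < z ∧
    Between (entry w i) (2 * n - 1 - entry w j) (2 * n - 1 - entry w z)
  have h1' := sum_ite_and_le (fun z => i < z ∧ z ≠ j)
    fun z => Between (entry w i) (2 * n - 1 - entry w j) (entry w z)
  have h2' := sum_ite_and_le (fun z => j < z)
    fun z => Between (entry w i) (2 * n - 1 - entry w j) (2 * n - 1 - entry w z)
  rw [sum_ite_Ioi] at h2'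
  rw [sum_ite_Ioi_ne i j h] at h1'
  have h1'' := sum_ite_nonneg fun z => (i < z ∧ z ≠ j) ∧
    Between (entry w i) (2 * n - 1 - entry w j) (entry w z)
  have h2'' := sum_ite_nonneg fun z => j < z ∧
    Between (entry w i) (2 * n - 1 - entry w j) (2 * n - 1 - entry w z)
  generalize (∑ z, if (i < z ∧ z ≠ j) ∧
      Between (entry w i) (2 * n - 1 - entry w j) (entry w z) then 1 else 0 : ℤ) = N₁ at *
  generalize (∑ z, if j < z ∧
      Between (entry w i) (2 * n - 1 - entry w j) (2 * n - 1 - entry w z) then 1 else 0 : ℤ) = N₂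
    at *
  have hcount := add_count_iff n i j (entry w i) (entry w j) (N₁ + N₂) _ h j.isLt (hlt i) (hlt j)
    (by omega) (by omega) hd
  have hzero : N₁ + N₂ = 0 ↔ N₁ = 0 ∧ N₂ = 0 := by omega
  rw [hzero] at hcount
  rw [hcount]
  refine and_congr_right fun ha => and_congr_right fun hb => ?_
  rw [h1, h2]
  constructor
  · rintro ⟨hP, hQ⟩
    refine ⟨fun z hiz hB => ?_, fun z hjz hB => hQ z ⟨hjz, hB⟩⟩
    -- The count omits `z = j`, but the claim may include it: the entry at `j` has the sign opposite
    -- to both ends of the interval.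
    by_cases hzj : z = j
    · subst hzj
      simp only [Between] at hB
      omega
    · exact hP z ⟨⟨hiz, hzj⟩, hB⟩
  · rintro ⟨hP, hQ⟩
    exact ⟨fun z hB => hP z hB.1.1 hB.2, fun z hB => hQ z hB.1 hB.2⟩

/-! ### Paths along a chain of roots -/

theorem isQBPath_append {w v : signedPerm n} {S T : List (PosRoot n × signedPerm n)} :
    IsQBPath w (S ++ T) v ↔ ∃ m, IsQBPath w S m ∧ IsQBPath m T v := by
  induction S generalizing w with
  | nil => simp [IsQBPath]
  | cons a S ih =>
    obtain ⟨α, x⟩ := a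
    simp only [List.cons_append, IsQBPath, ih]
    tauto

theorem isChain_pathVertices_append {R : signedPerm n → signedPerm n → Prop} {w m : signedPerm n}
    {S T : List (PosRoot n × signedPerm n)} (h : IsQBPath w S m)
    (hS : (pathVertices w S).IsChain R) (hT : (pathVertices m T).IsChain R) :
    (pathVertices w (S ++ T)).IsChain R := by
  induction S generalizing w with
  | nil =>
    obtain rfl : w = m := h
    exact hT
  | cons a S ih =>
    obtain ⟨α, x⟩ := a
    simp only [pathVertices, List.cons_append, List.map_cons, List.isChain_cons_cons] at hS ⊢
    exact ⟨hS.1, ih h.2 hS.2⟩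

theorem IsQBPath.end_unique {w v v' : signedPerm n} {S : List (PosRoot n × signedPerm n)}
    (h : IsQBPath w S v) (h' : IsQBPath w S v') : v = v' := by
  induction S generalizing w with
  | nil => exact h.symm.trans h'
  | cons a S ih => exact ih h.2 h'.2

/-- The vertices satisfying `A` are exactly the starting points of paths with labels forming a
subsequence of `L` which end in a vertex satisfying `B`; such a path is unique, and all its steps
satisfy `R`. -/
structure Segment (R : signedPerm n → signedPerm n → Prop) (A : signedPerm n → Prop)
    (L : List (PosRoot n)) (B : signedPerm n → Prop) : Prop where
  exists_path : ∀ w, A w → ∃ S v, IsQBPath w S v ∧ (pathLabels S).Sublist L ∧ B v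
  source : ∀ w S v, IsQBPath w S v → (pathLabels S).Sublist L → B v →
    A w ∧ (pathVertices w S).IsChain R
  unique : ∀ w S v S' v', IsQBPath w S v → (pathLabels S).Sublist L → B v →
    IsQBPath w S' v' → (pathLabels S').Sublist L → B v' → S = S'

namespace Segment

variable {R : signedPerm n → signedPerm n → Prop} {A B C : signedPerm n → Prop}
  {L M : List (PosRoot n)}

theorem nil (h : ∀ w, A w ↔ B w) : Segment R A [] B where
  exists_path w hw := ⟨[], w, rfl, List.Sublist.refl _, (h w).1 hw⟩
  source w S v hS hL hB := by
    obtain rfl : S = [] := by simpa [pathLabels] using hL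
    obtain rfl : w = v := hS
    exact ⟨(h w).2 hB, by simp [pathVertices]⟩
  unique w S v S' v' _ hL _ _ hL' _ := by
    have h1 : S = [] := by simpa [pathLabels] using hL
    have h2 : S' = [] := by simpa [pathLabels] using hL'
    rw [h1, h2]

theorem split {w v : signedPerm n} {S : List (PosRoot n × signedPerm n)} (h : IsQBPath w S v)
    (hL : (pathLabels S).Sublist (L ++ M)) :
    ∃ S₁ S₂ m, S = S₁ ++ S₂ ∧ IsQBPath w S₁ m ∧ IsQBPath m S₂ v ∧
      (pathLabels S₁).Sublist L ∧ (pathLabels S₂).Sublist M := by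
  obtain ⟨l₁, l₂, h1, h2, h3⟩ := List.sublist_append_iff.1 hL
  obtain ⟨S₁, S₂, rfl, rfl, rfl⟩ := List.map_eq_append_iff.1 h1
  obtain ⟨m, h4, h5⟩ := isQBPath_append.1 h
  exact ⟨S₁, S₂, m, rfl, h4, h5, h2, h3⟩

theorem append (h₁ : Segment R A L B) (h₂ : Segment R B M C) : Segment R A (L ++ M) C where
  exists_path w hw := by
    obtain ⟨S, m, h1, h2, h3⟩ := h₁.exists_path w hw
    obtain ⟨T, v, h4, h5, h6⟩ := h₂.exists_path m h3
    refine ⟨S ++ T, v, isQBPath_append.2 ⟨m, h1, h4⟩, ?_, h6⟩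
    simpa [pathLabels] using h2.append h5
  source w S v hS hL hC := by
    obtain ⟨S₁, S₂, m, rfl, h1, h2, h3, h4⟩ := split hS hL
    obtain ⟨h5, h6⟩ := h₂.source m S₂ v h2 h4 hC
    obtain ⟨h7, h8⟩ := h₁.source w S₁ m h1 h3 h5
    exact ⟨h7, isChain_pathVertices_append h1 h8 h6⟩
  unique w S v S' v' hS hL hC hS' hL' hC' := by
    obtain ⟨S₁, S₂, m, rfl, h1, h2, h3, h4⟩ := split hS hL
    obtain ⟨T₁, T₂, m', rfl, k1, k2, k3, k4⟩ := split hS' hL'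
    have h5 := (h₂.source m S₂ v h2 h4 hC).1
    have k5 := (h₂.source m' T₂ v' k2 k4 hC').1
    obtain rfl := h₁.unique w S₁ m T₁ m' h1 h3 h5 k1 k3 k5
    obtain rfl := h1.end_unique k1
    rw [h₂.unique m S₂ v T₂ v' h2 h4 hC k2 k4 hC']

theorem single (α : PosRoot n) (G : signedPerm n → Prop)
    (step : ∀ w, A w → G w → QBEdge w α (w * α.refl) ∧ B (w * α.refl))
    (stay : ∀ w, A w → ¬ G w → B w)
    (of_stay : ∀ w, B w → ¬ G w ∧ A w)
    (of_step : ∀ w, QBEdge w α (w * α.refl) → B (w * α.refl) → G w ∧ A w ∧ R w (w * α.refl)) :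
    Segment R A [α] B := by
  have key (w : signedPerm n) (S : List (PosRoot n × signedPerm n)) (v : signedPerm n)
      (hS : IsQBPath w S v) (hL : (pathLabels S).Sublist [α]) :
      (S = [] ∧ w = v) ∨ (S = [(α, w * α.refl)] ∧ w * α.refl = v ∧ QBEdge w α (w * α.refl)) := by
    match S, hS, hL with
    | [], hS, _ => exact Or.inl ⟨rfl, hS⟩
    | (β, x) :: T, hS, hL =>
      right
      have hlen := hL.length_le
      simp only [pathLabels, List.map_cons, List.length_cons, List.length_map,
        List.length_nil] at hlen
      obtain rfl : T = [] := List.eq_nil_of_length_eq_zero (by omega)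
      have hβ : β = α := by simpa [pathLabels] using hL
      subst hβ
      obtain ⟨hE, hv⟩ := hS
      obtain rfl : x = v := hv
      obtain rfl := hE.1
      exact ⟨rfl, rfl, hE⟩
  refine ⟨fun w hw => ?_, fun w S v hS hL hB => ?_, fun w S v S' v' hS hL hB hS' hL' hB' => ?_⟩
  · by_cases hG : G w
    · exact ⟨[(α, w * α.refl)], w * α.refl, ⟨(step w hw hG).1, rfl⟩, by simp [pathLabels],
        (step w hw hG).2⟩
    · exact ⟨[], w, rfl, by simp [pathLabels], stay w hw hG⟩
  · obtain ⟨rfl, rfl⟩ | ⟨rfl, rfl, hE⟩ := key w S v hS hL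
    · exact ⟨(of_stay _ hB).2, by simp [pathVertices]⟩
    · obtain ⟨_, hA, hR⟩ := of_step w hE hB
      exact ⟨hA, by simpa [pathVertices] using hR⟩
  · obtain ⟨rfl, rfl⟩ | ⟨rfl, rfl, hE⟩ := key w S v hS hL <;>
      obtain ⟨rfl, rfl⟩ | ⟨rfl, rfl, hE'⟩ := key w S' v' hS' hL'
    · rfl
    · exact absurd (of_step _ hE' hB').1 (of_stay _ hB).1
    · exact absurd (of_step _ hE hB).1 (of_stay _ hB').1
    · rfl

/-- `Q j` is the state when the blocks with index below `j` have been treated. -/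
theorem flatMap_finRange (m : ℕ) (F : Fin m → List (PosRoot n)) (Q : ℕ → signedPerm n → Prop)
    (h : ∀ j : Fin m, Segment R (Q j) (F j) (Q (j + 1))) :
    Segment R (Q 0) ((List.finRange m).flatMap F) (Q m) := by
  induction m with
  | zero => exact nil fun _ => Iff.rfl
  | succ m ih =>
    rw [List.finRange_succ_last, List.flatMap_append, List.flatMap_map]
    refine (ih (fun j => F j.castSucc) fun j => h j.castSucc).append ?_
    simpa using h (Fin.last m)

theorem flatMap_finRange_reverse (m : ℕ) (F : Fin m → List (PosRoot n))
    (Q : ℕ → signedPerm n → Prop) (h : ∀ j : Fin m, Segment R (Q (j + 1)) (F j) (Q j)) :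
    Segment R (Q m) ((List.finRange m).reverse.flatMap F) (Q 0) := by
  induction m with
  | zero => exact nil fun _ => Iff.rfl
  | succ m ih =>
    rw [List.finRange_succ_last, List.reverse_append, List.flatMap_append, ← List.map_reverse,
      List.flatMap_map]
    refine append (B := Q m) ?_ (ih (fun j => F j.castSucc) fun j => h j.castSucc)
    simpa using h (Fin.last m)

theorem congr {A' B' : signedPerm n → Prop} (h : Segment R A L B) (hA : ∀ w, A' w ↔ A w)
    (hB : ∀ w, B' w ↔ B w) : Segment R A' L B' := by
  obtain rfl : A' = A := funext fun w => propext (hA w)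
  obtain rfl : B' = B := funext fun w => propext (hB w)
  exact h

end Segment

/-! ### Targets, the counting principle and the intermediate states -/

/-- `z` lies in the half-open circular arc `(a, b]`. -/
def HalfArc (a b z : ℕ) : Prop := z ≠ a ∧ Arc a b z

/-- The first `k` values of `c` are letters with pairwise distinct absolute values. -/
structure IsTarget (k : ℕ) (c : Fin n → ℕ) : Prop where
  lt : ∀ j : Fin n, j.val < k → c j < 2 * n
  ne : ∀ i j : Fin n, i.val < k → j.val < k → i ≠ j → c i ≠ c j
  add_ne : ∀ i j : Fin n, i.val < k → j.val < k → c i + c j + 1 ≠ 2 * n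

/-- The matching condition, in terms of closed arcs. -/
def ArcCondition (k : ℕ) (c : Fin n → ℕ) (w : signedPerm n) : Prop :=
  ∀ i z : Fin n, i < z → z.val < k → ¬ Arc (entry w i) (c i) (c z)

/-- In the first `k` positions, the entries move from their old value towards the target. -/
def MovesToward (k : ℕ) (c : Fin n → ℕ) (w w' : signedPerm n) : Prop :=
  ∀ i : Fin n, i.val < k → Arc (entry w i) (c i) (entry w' i)

theorem exists_entry_of_lt (w : signedPerm n) (v : ℕ) (hv : v < 2 * n) :
    ∃ j, entry w j = v ∨ entry w j + v + 1 = 2 * n := exists_entry w ⟨v, hv⟩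

/-- If the letters of a symmetric set `S` all occur, up to bars, among the first `k` entries of
`w`, and positions with an entry in `S` have a target in `S`, then positions with a target in `S`
have an entry in `S`. -/
theorem entry_mem_of_target_mem {k : ℕ} {c : Fin n → ℕ} (hc : IsTarget k c) (w : signedPerm n)
    (S : ℕ → Prop) (hS : ∀ v v', v + v' + 1 = 2 * n → S v → S v')
    (hfree : ∀ z : Fin n, k ≤ z.val → ¬ S (entry w z))
    (hstay : ∀ j : Fin n, j.val < k → S (entry w j) → S (c j)) (j : Fin n) (hj : j.val < k)
    (hjS : S (c j)) : S (entry w j) := by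
  classical
  have hsub : (Finset.univ.filter fun j : Fin n => j.val < k ∧ S (entry w j)) ⊆
      Finset.univ.filter fun j : Fin n => j.val < k ∧ S (c j) := by
    intro j hj
    simp only [Finset.mem_filter, Finset.mem_univ, true_and] at hj ⊢
    exact ⟨hj.1, hstay j hj.1 hj.2⟩
  have hex (j : Fin n) : ∃ i, j.val < k → entry w i = c j ∨ entry w i + c j + 1 = 2 * n := by
    by_cases h : j.val < k
    · obtain ⟨i, hi⟩ := exists_entry_of_lt w (c j) (hc.lt j h)
      exact ⟨i, fun _ => hi⟩
    -- Outside the column the value of the choice function is irrelevant.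
    · exact ⟨j, fun h' => absurd h' h⟩
  choose φ hφ using hex
  -- A target in `S` is, up to bar, an entry in `S`, necessarily inside the column by `hfree`.
  -- Targets have distinct absolute values, so this assignment is injective and the inclusion `hsub`
  -- is an equality.
  have heq := Finset.eq_of_subset_of_card_le hsub (Finset.card_le_card_of_injOn φ
    (by
      intro j hj
      simp only [Finset.coe_filter, Finset.mem_univ, true_and, Set.mem_ofPred_eq] at hj ⊢
      have hSφ : S (entry w (φ j)) := by
        rcases hφ j hj.1 with h | h
        · rw [h]; exact hj.2
        · exact hS (c j) _ (by omega) hj.2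
      refine ⟨?_, hSφ⟩
      by_contra hk
      exact hfree _ (by omega) hSφ)
    (by
      intro i hi j hj hij
      simp only [Finset.coe_filter, Finset.mem_univ, true_and, Set.mem_ofPred_eq] at hi hj
      by_contra hne
      have h1 := hφ i hi.1
      have h2 := hφ j hj.1
      rw [hij] at h1
      have h3 := hc.ne i j hi.1 hj.1 hne
      have h4 := hc.add_ne i j hi.1 hj.1
      omega))
  have hmem : j ∈ Finset.univ.filter fun j : Fin n => j.val < k ∧ S (c j) := by simp [hj, hjS]
  rw [← heq] at hmem
  exact (Finset.mem_filter.1 hmem).2.2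

/-- The matching condition holds, and the entries in positions `t, …, k - 1` agree with the
target. -/
def MatchedFrom (k : ℕ) (c : Fin n → ℕ) (t : ℕ) (w : signedPerm n) : Prop :=
  ArcCondition k c w ∧ ∀ z : Fin n, t ≤ z.val → z.val < k → entry w z = c z

/-- The state before the root `ε_l - ε_j` is treated. -/
def SubState (k : ℕ) (c : Fin n → ℕ) (l : Fin n) (j : ℕ) (w : signedPerm n) : Prop :=
  MatchedFrom k c (l + 1) w ∧
    ∀ z : Fin n, k ≤ z.val → z.val < j → ¬ HalfArc (entry w l) (c l) (entry w z)

/-- The entry of `w` in position `l` can be moved to its target by increasing it within the letters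
of the same sign, and no letter that is met on the way occurs in a position `> l`. -/
def SignState (k : ℕ) (c : Fin n → ℕ) (l : Fin n) (w : signedPerm n) : Prop :=
  MatchedFrom k c (l + 1) w ∧ (∀ z, l < z → ¬ HalfArc (entry w l) (c l) (entry w z)) ∧
    entry w l ≤ c l ∧ (c l < n ∨ n ≤ entry w l)

/-- The state after the root `ε_l + ε_j` with `j ≥ k` is treated. -/
def FreeAddState (k : ℕ) (c : Fin n → ℕ) (l : Fin n) (j : ℕ) (w : signedPerm n) : Prop :=
  SignState k c l w ∧
    ∀ z : Fin n, j ≤ z.val → k ≤ z.val → ¬ HalfArc (entry w l) (c l) (2 * n - 1 - entry w z)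

/-- The state after the root `ε_i + ε_l` with `i < l` is treated. -/
def ColumnAddState (k : ℕ) (c : Fin n → ℕ) (l : Fin n) (i : ℕ) (w : signedPerm n) : Prop :=
  SignState k c l w ∧
    ∀ z : Fin n, i ≤ z.val ∨ l ≤ z → ¬ HalfArc (entry w l) (c l) (2 * n - 1 - entry w z)

/-! ### Roots `ε_l - ε_j` with `j` outside the column -/

section Steps

variable {k : ℕ} {c : Fin n → ℕ}

/-- A swap shortens the remaining arc at `l` and leaves the old entry behind it, so positions
already passed stay off the arc. With the later column entries off it too, this is what the edge
criterion asks for. -/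
theorem segment_sub (l j : Fin n) (hl : l.val < k) (hj : k ≤ j.val) (h : l < j) :
    Segment (MovesToward k c) (SubState k c l j) [.sub l j h] (SubState k c l (j + 1)) := by
  have hlj := h.ne'
  have e1 (w : signedPerm n) : entry (w * (PosRoot.sub l j h).refl) l = entry w j := by
    simp [entry_mul_refl_sub]
  have e2 (w : signedPerm n) : entry (w * (PosRoot.sub l j h).refl) j = entry w l := by
    simp [entry_mul_refl_sub, hlj]
  have e3 (w : signedPerm n) (z : Fin n) (h1 : z ≠ l) (h2 : z ≠ j) :
      entry (w * (PosRoot.sub l j h).refl) z = entry w z := by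
    simp [entry_mul_refl_sub, h1, h2]
  have hzj (z : Fin n) (hz : z.val < k) : z ≠ j := by rintro rfl; omega
  have hzl (z : Fin n) (hz : l < z) : z ≠ l := hz.ne'
  have hzl' (z : Fin n) (hz : k ≤ z.val) : z ≠ l := by rintro rfl; omega
  refine Segment.single _ (fun w => HalfArc (entry w l) (c l) (entry w j)) ?_ ?_ ?_ ?_
  · rintro w ⟨⟨cond, fix⟩, free⟩ hG
    refine ⟨(qbEdge_sub_iff w l j h).2 fun z h1 h2 => ?_, ⟨fun i z hi hz => ?_, fun z h1 h2 => ?_⟩,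
      fun z h1 h2 => ?_⟩
    · have hne : entry w z ≠ entry w l := fun h => h1.ne' (entry_injective w h)
      have hne : entry w z ≠ entry w j := fun h => h2.ne (entry_injective w h)
      by_cases hzk : z.val < k
      · have := cond l z h1 hzk
        rw [← fix z h1 hzk] at this
        simp only [HalfArc, Arc] at *
        omega
      · have := free z (by omega) h2
        simp only [HalfArc, Arc] at *
        omega
    · by_cases hil : i = l
      · subst hil
        rw [e1]
        have := cond i z hi hz
        simp only [HalfArc, Arc] at *
        omega
      · rw [e3 w i hil (hzj i (lt_trans hi hz))]
        exact cond i z hi hz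
    · rw [e3 w z (hzl z h1) (hzj z h2)]
      exact fix z h1 h2
    · rw [e1]
      by_cases hz : z = j
      · subst hz
        rw [e2]
        simp only [HalfArc, Arc] at *
        omega
      · rw [e3 w z (hzl' z h1) hz]
        have := free z h1 (by have := Fin.val_ne_of_ne hz; omega)
        simp only [HalfArc, Arc] at *
        omega
  · rintro w ⟨hB, free⟩ hG
    refine ⟨hB, fun z h1 h2 => ?_⟩
    by_cases hz : z = j
    · subst hz; exact hG
    · exact free z h1 (by have := Fin.val_ne_of_ne hz; omega)
  · rintro w ⟨hB, free⟩
    exact ⟨free j hj (by omega), hB, fun z h1 h2 => free z h1 (by omega)⟩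
  · rintro w hE ⟨⟨cond, fix⟩, free⟩
    rw [qbEdge_sub_iff] at hE
    have hne : entry w j ≠ entry w l := fun h => hlj (entry_injective w h)
    -- The old entry lies off the arc from the new entry to the target, so going around from the old
    -- entry meets the new one no later than the target.
    have hG : HalfArc (entry w l) (c l) (entry w j) := by
      have := free j hj (by omega)
      rw [e1, e2] at this
      simp only [HalfArc, Arc] at *
      omega
    have fix' (z : Fin n) (h1 : l.val + 1 ≤ z.val) (h2 : z.val < k) : entry w z = c z := by
      rw [← e3 w z (hzl z h1) (hzj z h2)]
      exact fix z h1 h2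
    refine ⟨hG, ⟨⟨fun i z hi hz => ?_, fix'⟩, fun z h1 h2 => ?_⟩, fun i hi => ?_⟩
    · by_cases hil : i = l
      · subst hil
        have h1 := cond i z hi hz
        have h2 := hE z hi (by omega)
        have h3 : entry w z ≠ entry w i := fun h => hi.ne' (entry_injective w h)
        rw [e1] at h1
        rw [fix' z hi hz] at h2 h3
        simp only [HalfArc, Arc] at *
        omega
      · rw [← e3 w i hil (hzj i (lt_trans hi hz))]
        exact cond i z hi hz
    · have h3 := free z h1 (by omega)
      have hz : z ≠ j := by rintro rfl; omega
      rw [e1, e3 w z (hzl' z h1) hz] at h3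
      have h4 := hE z (by omega) h2
      have h5 : entry w z ≠ entry w j := fun h => hz (entry_injective w h)
      simp only [HalfArc, Arc] at *
      omega
    · by_cases hil : i = l
      · subst hil
        rw [e1]
        exact hG.2
      · rw [e3 w i hil (hzj i hi)]
        simp only [Arc]
        omega

end Steps

/-! ### The long root and the roots `ε_l + ε_j` -/

section Steps

variable {k : ℕ} {c : Fin n → ℕ}

/-- If the arc from `y` to the target changed sign without meeting the bar of `y`, the symmetric arc
from the bar of `c l` to `c l` would lie inside it and miss `y`. Counting in that arc then forces
the entry at `l` into it, a contradiction. -/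
theorem same_sign_of_not_halfArc_bar (hc : IsTarget k c) (l : Fin n) (hl : l.val < k)
    (w : signedPerm n) (y : ℕ) (hy : y = entry w l ∨ y = 2 * n - 1 - entry w l)
    (hB : MatchedFrom k c (l + 1) w) (hall : ∀ z, l < z → ¬ HalfArc y (c l) (entry w z))
    (hbar : ¬ HalfArc y (c l) (2 * n - 1 - y)) : y ≤ c l ∧ (c l < n ∨ n ≤ y) := by
  obtain ⟨cond, fix⟩ := hB
  have hlt := entry_lt w
  have hcl := hc.lt l hl
  by_contra hcon
  have hS := entry_mem_of_target_mem hc w (fun v => Arc (2 * n - 1 - c l) (c l) v)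
    (by intro v v' hv h; simp only [Arc] at *; omega)
    (by
      intro z hz h
      have h1 := hall z (by omega)
      have := hlt z
      have := hlt l
      simp only [HalfArc, Arc] at *
      omega)
    (by
      intro j hj h
      rcases lt_trichotomy j l with hjl | hjl | hjl
      -- An earlier position with its entry in the symmetric arc cannot leave it without crossing `c
      -- l`, which the matching condition forbids.
      · have := cond j l hjl hl
        have := hlt j
        have := hc.lt j hj
        simp only [Arc] at *
        omega
      · subst hjl
        have := hlt j
        simp only [HalfArc, Arc] at *
        omega
      · rw [fix j hjl hj] at h
        exact h)
    l hl
    (by simp only [Arc]; omega)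
  have := hlt l
  simp only [HalfArc, Arc] at *
  omega

/-- The sign is changed exactly when the bar of the entry is on the way to the target. Afterwards
the bar is off the remaining arc, so that arc stays within one sign. -/
theorem segment_dbl (hc : IsTarget k c) (l : Fin n) (hl : l.val < k) :
    Segment (MovesToward k c) (SubState k c l n) [.dbl l] (FreeAddState k c l n) := by
  have e1 (w : signedPerm n) : entry (w * (PosRoot.dbl l).refl) l = 2 * n - 1 - entry w l := by
    simp [entry_mul_refl_dbl]
  have e3 (w : signedPerm n) (z : Fin n) (h1 : z ≠ l) :
      entry (w * (PosRoot.dbl l).refl) z = entry w z := by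
    simp [entry_mul_refl_dbl, h1]
  have hcl := hc.lt l hl
  have hzl (z : Fin n) (hz : l < z) : z ≠ l := hz.ne'
  have hall (w : signedPerm n) (hw : SubState k c l n w) (z : Fin n) (hz : l < z) :
      ¬ HalfArc (entry w l) (c l) (entry w z) := by
    by_cases hzk : z.val < k
    · have := hw.1.1 l z hz hzk
      rw [← hw.1.2 z hz hzk] at this
      exact fun h => this h.2
    · exact hw.2 z (by omega) z.isLt
  refine Segment.single _ (fun w => HalfArc (entry w l) (c l) (2 * n - 1 - entry w l)) ?_ ?_ ?_ ?_
  · intro w hw hG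
    have hw' := hall w hw
    obtain ⟨⟨cond, fix⟩, free⟩ := hw
    have hlt := entry_lt w
    have hltl := hlt l
    have hB : MatchedFrom k c (l + 1) (w * (PosRoot.dbl l).refl) := by
      refine ⟨fun i z hi hz => ?_, fun z h1 h2 => ?_⟩
      · by_cases hil : i = l
        · subst hil
          rw [e1]
          have := cond i z hi hz
          simp only [HalfArc, Arc] at *
          omega
        · rw [e3 w i hil]
          exact cond i z hi hz
      · rw [e3 w z (hzl z h1)]
        exact fix z h1 h2
    have hall' (z : Fin n) (hz : l < z) : ¬ HalfArc (entry (w * (PosRoot.dbl l).refl) l) (c l)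
        (entry (w * (PosRoot.dbl l).refl) z) := by
      rw [e1, e3 w z (hzl z hz)]
      have := hw' z hz
      simp only [HalfArc, Arc] at *
      omega
    refine ⟨(qbEdge_dbl_iff w l).2 fun z h1 => ?_, ⟨⟨hB, hall', ?_⟩, fun z h1 _ => ?_⟩⟩
    · have := hw' z h1
      have := entry_add_ne w l z
      have : entry w z ≠ entry w l := fun h => h1.ne' (entry_injective w h)
      simp only [HalfArc, Arc] at *
      omega
    · refine same_sign_of_not_halfArc_bar hc l hl _ _ (Or.inl rfl) hB hall' ?_
      rw [e1]
      simp only [HalfArc, Arc] at *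
      omega
    · exact absurd z.isLt (by omega)
  · intro w hw hG
    refine ⟨⟨hw.1, hall w hw, ?_⟩, fun z h1 _ => absurd z.isLt (by omega)⟩
    exact same_sign_of_not_halfArc_bar hc l hl w _ (Or.inl rfl) hw.1 (hall w hw) hG
  · rintro w ⟨⟨hB, hw, hs⟩, -⟩
    have hltl := entry_lt w l
    refine ⟨?_, hB, fun z h1 _ => hw z (by omega)⟩
    simp only [HalfArc, Arc]
    omega
  · rintro w hE ⟨⟨⟨cond, fix⟩, hw, hs⟩, -⟩
    rw [qbEdge_dbl_iff] at hE
    rw [e1] at hs hw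
    have hlt := entry_lt w
    have hltl := hlt l
    -- The new entry and the target share a sign, with the target not smaller; from the opposite
    -- sign the bar is therefore met first.
    have hG : HalfArc (entry w l) (c l) (2 * n - 1 - entry w l) := by
      simp only [HalfArc, Arc]
      omega
    have fix' (z : Fin n) (h1 : l.val + 1 ≤ z.val) (h2 : z.val < k) : entry w z = c z := by
      rw [← e3 w z (hzl z h1)]
      exact fix z h1 h2
    refine ⟨hG, ⟨⟨fun i z hi hz => ?_, fix'⟩, fun z h1 h2 => ?_⟩, fun i hi => ?_⟩
    · by_cases hil : i = l
      · subst hil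
        have h1 := cond i z hi hz
        have h2 := hE z hi
        have h3 : entry w z ≠ entry w i := fun h => hi.ne' (entry_injective w h)
        rw [e1] at h1
        rw [fix' z hi hz] at h2 h3
        simp only [HalfArc, Arc] at *
        omega
      · rw [← e3 w i hil]
        exact cond i z hi hz
    · have hlz : l < z := by omega
      have h3 := hw z hlz
      rw [e3 w z (hzl z hlz)] at h3
      have h4 := hE z hlz
      have h5 := entry_add_ne w l z
      simp only [HalfArc, Arc] at *
      omega
    · by_cases hil : i = l
      · subst hil
        rw [e1]
        exact hG.2
      · rw [e3 w i hil]
        simp only [Arc]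
        omega

/-- The remaining arc lies within one sign, so a step towards the target is automatically a rise of
the kind the edge criterion admits. The positions `j` come in decreasing order, which is why the
bars checked so far are those at positions beyond `j`. -/
theorem segment_add_free (hc : IsTarget k c) (l j : Fin n) (hl : l.val < k) (hj : k ≤ j.val)
    (h : l < j) :
    Segment (MovesToward k c) (FreeAddState k c l (j + 1)) [.add l j h] (FreeAddState k c l j) := by
  have hlj := h.ne'
  have e1 (w : signedPerm n) : entry (w * (PosRoot.add l j h).refl) l = 2 * n - 1 - entry w j := by
    simp [entry_mul_refl_add]
  have e2 (w : signedPerm n) : entry (w * (PosRoot.add l j h).refl) j = 2 * n - 1 - entry w l := by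
    simp [entry_mul_refl_add, hlj]
  have e3 (w : signedPerm n) (z : Fin n) (h1 : z ≠ l) (h2 : z ≠ j) :
      entry (w * (PosRoot.add l j h).refl) z = entry w z := by
    simp [entry_mul_refl_add, h1, h2]
  have hzj (z : Fin n) (hz : z.val < k) : z ≠ j := by rintro rfl; omega
  have hzl (z : Fin n) (hz : l < z) : z ≠ l := hz.ne'
  have hzl' (z : Fin n) (hz : k ≤ z.val) : z ≠ l := by rintro rfl; omega
  have hcl := hc.lt l hl
  refine Segment.single _ (fun w => HalfArc (entry w l) (c l) (2 * n - 1 - entry w j)) ?_ ?_ ?_ ?_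
  · rintro w ⟨⟨⟨cond, fix⟩, hw, hs⟩, free⟩ hG
    have hlt := entry_lt w
    have hltl := hlt l
    have hltj := hlt j
    refine ⟨(qbEdge_add_iff w l j h).2 ⟨?_, ?_, fun z hz => ?_, fun z hz => ?_⟩,
      ⟨⟨⟨fun i z hi hz => ?_, fun z h1 h2 => ?_⟩, fun z hz => ?_, ?_⟩, fun z h1 h2 => ?_⟩⟩
    · simp only [HalfArc, Arc] at *
      omega
    · simp only [HalfArc, Arc] at *
      omega
    · have := hw z hz
      simp only [HalfArc, Arc, Between] at *
      omega
    · have := free z hz (by omega)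
      simp only [HalfArc, Arc, Between] at *
      omega
    · by_cases hil : i = l
      · subst hil
        rw [e1]
        have := cond i z hi hz
        simp only [HalfArc, Arc] at *
        omega
      · rw [e3 w i hil (hzj i (lt_trans hi hz))]
        exact cond i z hi hz
    · rw [e3 w z (hzl z h1) (hzj z h2)]
      exact fix z h1 h2
    · rw [e1]
      by_cases hzj : z = j
      · subst hzj
        rw [e2]
        simp only [HalfArc, Arc] at *
        omega
      · rw [e3 w z (hzl z hz) hzj]
        have := hw z hz
        simp only [HalfArc, Arc] at *
        omega
    · rw [e1]
      simp only [HalfArc, Arc] at *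
      omega
    · rw [e1]
      by_cases hzj : z = j
      · subst hzj
        rw [e2]
        simp only [HalfArc, Arc] at *
        omega
      · rw [e3 w z (hzl' z h2) hzj]
        have := free z (by have := Fin.val_ne_of_ne hzj; omega) h2
        simp only [HalfArc, Arc] at *
        omega
  · rintro w ⟨hB, free⟩ hG
    refine ⟨hB, fun z h1 h2 => ?_⟩
    by_cases hz : z = j
    · subst hz; exact hG
    · exact free z (by have := Fin.val_ne_of_ne hz; omega) h2
  · rintro w ⟨hB, free⟩
    exact ⟨free j le_rfl hj, hB, fun z h1 h2 => free z (by omega) h2⟩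
  · rintro w hE ⟨⟨⟨cond, fix⟩, hw, hs⟩, free⟩
    rw [qbEdge_add_iff] at hE
    obtain ⟨hE1, hE2, hE3, hE4⟩ := hE
    rw [e1] at hs hw free
    have hlt := entry_lt w
    have hltl := hlt l
    have hltj := hlt j
    have hG : HalfArc (entry w l) (c l) (2 * n - 1 - entry w j) := by
      simp only [HalfArc, Arc]
      omega
    have fix' (z : Fin n) (h1 : l.val + 1 ≤ z.val) (h2 : z.val < k) : entry w z = c z := by
      rw [← e3 w z (hzl z h1) (hzj z h2)]
      exact fix z h1 h2
    refine ⟨hG, ⟨⟨⟨fun i z hi hz => ?_, fix'⟩, fun z hz => ?_, ?_⟩, fun z h1 h2 => ?_⟩,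
      fun i hi => ?_⟩
    · by_cases hil : i = l
      · subst hil
        have h1 := cond i z hi hz
        have h2 := hE3 z hi
        have h3 : entry w z ≠ entry w i := fun h => hi.ne' (entry_injective w h)
        rw [e1] at h1
        rw [fix' z hi hz] at h2 h3
        simp only [HalfArc, Arc, Between] at *
        omega
      · rw [← e3 w i hil (hzj i (lt_trans hi hz))]
        exact cond i z hi hz
    · by_cases hzj : z = j
      · subst hzj
        simp only [HalfArc, Arc] at *
        omega
      · have h1 := hw z hz
        rw [e3 w z (hzl z hz) hzj] at h1
        have h2 := hE3 z hz
        have h3 := entry_add_ne w j z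
        simp only [HalfArc, Arc, Between] at *
        omega
    · omega
    · have hzj : z ≠ j := by rintro rfl; omega
      have h3 := free z (by omega) h2
      rw [e3 w z (hzl' z h2) hzj] at h3
      have h4 := hE4 z h1
      have h5 : entry w z ≠ entry w j := fun h => hzj (entry_injective w h)
      have h6 := hlt z
      simp only [HalfArc, Arc, Between] at *
      omega
    · by_cases hil : i = l
      · subst hil
        rw [e1]
        exact hG.2
      · rw [e3 w i hil (hzj i hi)]
        simp only [Arc]
        omega

/-- For a matched position `z > l`, if the bar of `c z` were on the remaining arc, the interval from
it to `c l` together with its mirror image would be a set to which the counting principle applies: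
it contains the target at `l` but not the entry. -/
theorem columnAddState_of_freeAddState (hc : IsTarget k c) (l : Fin n) (hl : l.val < k)
    (w : signedPerm n) (hw : FreeAddState k c l 0 w) : ColumnAddState k c l l w := by
  obtain ⟨⟨⟨cond, fix⟩, hall, hs⟩, free⟩ := hw
  refine ⟨⟨⟨cond, fix⟩, hall, hs⟩, fun z hz hcon => ?_⟩
  have hlt := entry_lt w
  have hltl := hlt l
  have hcl := hc.lt l hl
  have hlz : l ≤ z := by omega
  by_cases hzk : z.val < k
  swap
  · exact free z (Nat.zero_le _) (by omega) hcon
  by_cases hzl : z = l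
  · subst hzl
    simp only [HalfArc, Arc] at *
    omega
  have hlz' : l < z := lt_of_le_of_ne hlz (Ne.symm hzl)
  have hez := fix z hlz' hzk
  have hcz := hc.lt z hzk
  rw [hez] at hcon
  have hS := entry_mem_of_target_mem hc w
    (fun v => (2 * n - 1 - c l ≤ v ∧ v ≤ c z) ∨ (2 * n - 1 - c z ≤ v ∧ v ≤ c l))
    (by intro v v' hv h; omega)
    (by
      intro y hy h
      have h1 := free y (Nat.zero_le _) hy
      have h2 := hall y (by omega)
      have := hlt y
      simp only [HalfArc, Arc] at *
      omega)
    (by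
      intro j hj h
      rcases lt_trichotomy j l with hjl | hjl | hjl
      · have := cond j l hjl hl
        have := cond j z (lt_trans hjl hlz') hzk
        have := hlt j
        have := hc.lt j hj
        simp only [HalfArc, Arc] at *
        omega
      · subst hjl
        simp only [HalfArc, Arc] at *
        omega
      · rw [fix j hjl hj] at h
        exact h)
    l hl
    (by simp only [HalfArc, Arc] at hcon; omega)
  simp only [HalfArc, Arc] at *
  omega

/-- Besides `l`, this reflection moves position `i`, whose own block comes later. The extra work is
to show that the entry at `i` also moves towards its target and that the matching condition at `i`
is neither lost nor created illegitimately. -/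
theorem segment_add_column (hc : IsTarget k c) (i l : Fin n) (hl : l.val < k) (h : i < l) :
    Segment (MovesToward k c) (ColumnAddState k c l (i + 1)) [.add i l h]
      (ColumnAddState k c l i) := by
  have hil := h.ne'
  have e1 (w : signedPerm n) : entry (w * (PosRoot.add i l h).refl) l = 2 * n - 1 - entry w i := by
    simp [entry_mul_refl_add, hil]
  have e2 (w : signedPerm n) : entry (w * (PosRoot.add i l h).refl) i = 2 * n - 1 - entry w l := by
    simp [entry_mul_refl_add]
  have e3 (w : signedPerm n) (z : Fin n) (h1 : z ≠ i) (h2 : z ≠ l) :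
      entry (w * (PosRoot.add i l h).refl) z = entry w z := by
    simp [entry_mul_refl_add, h1, h2]
  have hzl (z : Fin n) (hz : l < z) : z ≠ l := hz.ne'
  have hzi (z : Fin n) (hz : l < z) : z ≠ i := (h.trans hz).ne'
  have hcl := hc.lt l hl
  have hik : i.val < k := lt_trans h hl
  have hci := hc.lt i hik
  refine Segment.single _ (fun w => HalfArc (entry w l) (c l) (2 * n - 1 - entry w i)) ?_ ?_ ?_ ?_
  · rintro w ⟨⟨⟨cond, fix⟩, hw, hs⟩, free⟩ hG
    have hlt := entry_lt w
    have hltl := hlt l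
    have hlti := hlt i
    -- The entry at `i` must not overshoot its target. If it did, counting in the interval from the
    -- bar of `c l` to `c i` and its mirror would force the entry at `l` into this set.
    have hjump : ¬ (entry w i ≤ c i ∧ c i < 2 * n - 1 - entry w l) := by
      intro hcon
      have hS := entry_mem_of_target_mem hc w
        (fun v => (2 * n - 1 - c l ≤ v ∧ v ≤ c i) ∨ (2 * n - 1 - c i ≤ v ∧ v ≤ c l))
        (by intro v v' hv h; omega)
        (by
          intro y hy h
          have h1 := free y (by omega)
          have h2 := hw y (by omega)
          have := hlt y
          simp only [HalfArc, Arc] at *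
          omega)
        (by
          intro j hj h
          rcases lt_trichotomy j l with hjl | hjl | hjl
          · have h1 := cond j l hjl hl
            have := hlt j
            have := hc.lt j hj
            rcases lt_trichotomy j i with hji | hji | hji
            · have := cond j i hji hik
              simp only [HalfArc, Arc] at *
              omega
            · subst hji
              omega
            · have := free j (by omega)
              simp only [HalfArc, Arc] at *
              omega
          · subst hjl
            simp only [HalfArc, Arc] at *
            omega
          · rw [fix j hjl hj] at h
            exact h)
        l hl (by simp only [HalfArc, Arc] at hG; omega)
      simp only [HalfArc, Arc] at *
      omega
    refine ⟨(qbEdge_add_iff w i l h).2 ⟨?_, ?_, fun z hz => ?_, fun z hz => ?_⟩,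
      ⟨⟨⟨fun j z hj hz => ?_, fun z h1 h2 => ?_⟩, fun z hz => ?_, ?_⟩, fun z h1 => ?_⟩⟩
    · simp only [HalfArc, Arc] at *
      omega
    · simp only [HalfArc, Arc] at *
      omega
    · have := free z (by omega)
      have := hlt z
      simp only [HalfArc, Arc, Between] at *
      omega
    · have := hw z hz
      have := hlt z
      simp only [HalfArc, Arc, Between] at *
      omega
    · by_cases hjl : j = l
      · subst hjl
        rw [e1]
        have := cond j z hj hz
        simp only [HalfArc, Arc] at *
        omega
      by_cases hji : j = i
      · subst hji
        rw [e2]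
        have := cond j z hj hz
        simp only [HalfArc, Arc] at *
        omega
      · rw [e3 w j hji hjl]
        exact cond j z hj hz
    · rw [e3 w z (hzi z h1) (hzl z h1)]
      exact fix z h1 h2
    · rw [e1, e3 w z (hzi z hz) (hzl z hz)]
      have := hw z hz
      simp only [HalfArc, Arc] at *
      omega
    · rw [e1]
      simp only [HalfArc, Arc] at *
      omega
    · rw [e1]
      by_cases hzl : z = l
      · subst hzl
        rw [e1]
        simp only [HalfArc, Arc] at *
        omega
      by_cases hzi : z = i
      · subst hzi
        rw [e2]
        simp only [HalfArc, Arc] at *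
        omega
      · rw [e3 w z hzi hzl]
        have := free z (by have := Fin.val_ne_of_ne hzi; omega)
        simp only [HalfArc, Arc] at *
        omega
  · rintro w ⟨hB, free⟩ hG
    refine ⟨hB, fun z h1 => ?_⟩
    by_cases hz : z = i
    · subst hz; exact hG
    · exact free z (by have := Fin.val_ne_of_ne hz; omega)
  · rintro w ⟨hB, free⟩
    exact ⟨free i (Or.inl le_rfl), hB, fun z h1 => free z (by omega)⟩
  · rintro w hE ⟨⟨⟨cond, fix⟩, hw, hs⟩, free⟩
    rw [qbEdge_add_iff] at hE
    obtain ⟨hE1, hE2, hE3, hE4⟩ := hE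
    have hlt := entry_lt w
    have hltl := hlt l
    have hlti := hlt i
    -- Going backwards, no target at a position from `i` to `l - 1` may be skipped by the entry at
    -- `i`: `z = i` gives monotonicity, the others the matching condition before the step.
    have hjump (z : Fin n) (hiz : i ≤ z) (hzl' : z < l) :
        ¬ (entry w i ≤ c z ∧ c z < 2 * n - 1 - entry w l) := by
      intro hcon
      have hzk : z.val < k := lt_trans hzl' hl
      have hcz := hc.lt z hzk
      have hin (j : Fin n) (hij : i ≤ j) (hjl : j < l) :
          ¬ (2 * n - 1 - c l ≤ entry (w * (PosRoot.add i l h).refl) j ∧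
            entry (w * (PosRoot.add i l h).refl) j ≤ c z) := by
        by_cases hji : j = i
        · subst hji
          rw [e2]
          omega
        · have h1 := free j (Or.inl hij)
          have h2 := hE3 j (lt_of_le_of_ne hij (Ne.symm hji))
          have h3 : entry w j ≠ entry w i := fun h => hji (entry_injective w h)
          have h4 := hlt j
          rw [e1] at h1 hs
          rw [e3 w j hji hjl.ne] at h1 ⊢
          simp only [HalfArc, Arc, Between] at *
          omega
      have hS := entry_mem_of_target_mem hc (w * (PosRoot.add i l h).refl)
        (fun v => (2 * n - 1 - c l ≤ v ∧ v ≤ c z) ∨ (2 * n - 1 - c z ≤ v ∧ v ≤ c l))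
        (by intro v v' hv h; omega)
        (by
          intro y hy h
          have hly : l < y := by omega
          have h1 := free y (by omega)
          have h2 := hw y hly
          have h3 := hE3 y (by omega)
          have h4 := hE4 y hly
          have h5 := hlt y
          have h6 := entry_add_ne w i y
          have h7 : entry w y ≠ entry w i := fun h => hzi y hly (entry_injective w h)
          rw [e1] at h1 h2 hs
          rw [e3 w y (hzi y hly) (hzl y hly)] at h h1 h2
          simp only [HalfArc, Arc, Between] at *
          omega)
        (by
          intro j hj h
          rcases lt_trichotomy j l with hjl | hjl | hjl
          · have h1 := cond j l hjl hl
            have := entry_lt (w * (PosRoot.add i l ‹_›).refl) j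
            have := hc.lt j hj
            by_cases hji : j < i
            · have := cond j z (by omega) hzk
              simp only [Arc] at *
              omega
            · have := hin j (by omega) hjl
              simp only [Arc] at *
              omega
          · subst hjl
            right
            rw [e1] at hs
            omega
          · rw [fix j hjl hj] at h
            exact h)
        z hzk (by rw [e1] at hs; omega)
      -- Counting puts the new entry at `z` in the set, and `hin` leaves only the half ending at `c
      -- l`. From there the arc to `c z` passes `c l`, against the matching condition.
      have h1 := hin z hiz hzl'
      have h2 := cond z l hzl' hl
      have h3 := entry_lt (w * (PosRoot.add i l h).refl) z
      rw [e1] at hs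
      simp only [Arc] at *
      omega
    rw [e1] at hs hw free
    have hG : HalfArc (entry w l) (c l) (2 * n - 1 - entry w i) := by
      simp only [HalfArc, Arc]
      omega
    have fix' (z : Fin n) (h1 : l.val + 1 ≤ z.val) (h2 : z.val < k) : entry w z = c z := by
      rw [← e3 w z (hzi z h1) (hzl z h1)]
      exact fix z h1 h2
    have hmove : Arc (entry w i) (c i) (2 * n - 1 - entry w l) := by
      have := hjump i le_rfl h
      simp only [Arc]
      omega
    refine ⟨hG, ⟨⟨⟨fun j z hj hz => ?_, fix'⟩, fun z hz => ?_, ?_⟩, fun z h1 => ?_⟩,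
      fun j hj => ?_⟩
    · by_cases hjl : j = l
      · subst hjl
        have h1 := cond j z hj hz
        have h2 := hE4 z hj
        have h3 := hlt z
        have h4 : entry w z ≠ entry w j := fun h => hj.ne' (entry_injective w h)
        have h5 := hE3 z (by omega)
        rw [e1] at h1
        rw [fix' z hj hz] at h2 h3 h4 h5
        have h6 := entry_add_ne w i z
        rw [fix' z hj hz] at h6
        simp only [HalfArc, Arc, Between] at *
        omega
      by_cases hji : j = i
      · subst hji
        have h1 := cond j z hj hz
        rw [e2] at h1
        have hcz := hc.lt z hz
        -- Undoing the step lengthens the arc at this position. A target in the added piece is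
        -- excluded by counting for `z < l`, by sign for `z = l`, and by the edge criterion for `z >
        -- l`.
        have hnot : ¬ (entry w j ≤ c z ∧ c z < 2 * n - 1 - entry w l) := by
          rcases lt_trichotomy z l with hzl | hzl | hzl
          · exact hjump z hj.le hzl
          · subst hzl
            omega
          · have h2 := hE3 z hj
            have h3 : entry w z ≠ entry w j := fun h => hj.ne' (entry_injective w h)
            rw [fix' z hzl hz] at h2 h3
            simp only [Between] at *
            omega
        simp only [HalfArc, Arc] at *
        omega
      · rw [← e3 w j hji hjl]
        exact cond j z hj hz
    · have h1 := hw z hz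
      rw [e3 w z (hzi z hz) (hzl z hz)] at h1
      have h2 := hE4 z hz
      have h3 := hlt z
      have h4 := entry_add_ne w i z
      simp only [HalfArc, Arc, Between] at *
      omega
    · omega
    · by_cases hzl : z = l
      · subst hzl
        simp only [HalfArc, Arc] at *
        omega
      · have hzi : z ≠ i := by rintro rfl; omega
        have h2 := free z (by omega)
        rw [e3 w z hzi hzl] at h2
        have h3 := hE3 z (by omega)
        have h4 : entry w z ≠ entry w i := fun h => hzi (entry_injective w h)
        have h5 := hlt z
        simp only [HalfArc, Arc, Between] at *
        omega
    · by_cases hjl : j = l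
      · subst hjl
        rw [e1]
        exact hG.2
      by_cases hji : j = i
      · subst hji
        rw [e2]
        exact hmove
      · rw [e3 w j hji hjl]
        simp only [Arc]
        omega

end Steps

/-! ### Assembling the chain and returning to columns -/

section Columns

variable {k : ℕ}

theorem segment_gammaSegment {c : Fin n → ℕ} (hc : IsTarget k c) (hk : k ≤ n) (l : Fin k) :
    Segment (MovesToward k c) (MatchedFrom k c (l + 1)) (gammaSegment hk l).reverse
      (MatchedFrom k c l) := by
  have hl : (Fin.castLE hk l).val < k := l.isLt
  simp only [gammaSegment, List.reverse_append, ← List.filterMap_reverse, List.reverse_reverse,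
    List.reverse_singleton]
  simp only [List.filterMap_eq_flatMap_toList]
  refine Segment.append (B := SubState k c (Fin.castLE hk l) n) ?_
    (Segment.append (segment_dbl hc (Fin.castLE hk l) hl)
    (Segment.append (B := FreeAddState k c (Fin.castLE hk l) 0) ?_ ?_))
  · refine (Segment.flatMap_finRange n _ (SubState k c (Fin.castLE hk l)) fun j => ?_).congr
      (fun w => ?_) fun w => Iff.rfl
    · by_cases hj : k ≤ j.val
      · simp only [hj, dif_pos, Option.toList_some]
        exact segment_sub _ j hl hj _
      · simp only [hj, dif_neg, not_false_iff, Option.toList_none]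
        refine Segment.nil fun w => and_congr_right fun _ => forall_congr' fun z => ?_
        exact ⟨fun h h1 _ => h h1 (by omega), fun h h1 _ => h h1 (by omega)⟩
    · exact ⟨fun h => ⟨h, fun z _ hz => absurd hz (Nat.not_lt_zero _)⟩, fun h => h.1⟩
  · refine Segment.flatMap_finRange_reverse n _ (FreeAddState k c (Fin.castLE hk l)) fun j => ?_
    by_cases hj : k ≤ j.val
    · simp only [hj, dif_pos, Option.toList_some]
      exact segment_add_free hc _ j hl hj _
    · simp only [hj, dif_neg, not_false_iff, Option.toList_none]
      refine Segment.nil fun w => and_congr_right fun _ => forall_congr' fun z => ?_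
      exact ⟨fun h _ h1 => h (by omega) h1, fun h _ h1 => h (by omega) h1⟩
  · refine (Segment.flatMap_finRange_reverse n _ (ColumnAddState k c (Fin.castLE hk l))
      fun i => ?_).congr (fun w => ?_) fun w => ?_
    · by_cases hi : i < Fin.castLE hk l
      · simp only [hi, dif_pos, Option.toList_some]
        exact segment_add_column hc i _ hl hi
      · simp only [hi, dif_neg, not_false_iff, Option.toList_none]
        refine Segment.nil fun w => and_congr_right fun _ => forall_congr' fun z => ?_
        exact ⟨fun h h1 => h (by omega), fun h h1 => h (by omega)⟩
    · constructor
      · intro h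
        -- At index `n` only the positions `z ≥ l` are constrained, as at index `l`: the roots with
        -- `i ≥ l` are absent from the chain.
        have := columnAddState_of_freeAddState hc _ hl w h
        exact ⟨this.1, fun z hz => this.2 z (by have := z.isLt; omega)⟩
      · rintro ⟨h1, h2⟩
        exact ⟨h1, fun z _ hz => h2 z (Or.inr (Fin.le_def.2 (by omega)))⟩
    · constructor
      · rintro ⟨cond, fix⟩
        have hlv := fix (Fin.castLE hk l) le_rfl hl
        have hcl := hc.lt _ hl
        have hempty (z : ℕ) : ¬ HalfArc (c (Fin.castLE hk l)) (c (Fin.castLE hk l)) z := by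
          simp only [HalfArc, Arc]
          omega
        refine ⟨⟨⟨cond, fun z hz => fix z (by simp only [Fin.val_castLE] at hz; omega)⟩,
          ?_, ?_⟩, ?_⟩
        · intro z _
          rw [hlv]
          exact hempty _
        · rw [hlv]
          omega
        · intro z _
          rw [hlv]
          exact hempty _
      · rintro ⟨⟨⟨cond, fix⟩, hw, hs⟩, hall⟩
        refine ⟨cond, fun z h1 h2 => ?_⟩
        by_cases hz : z = Fin.castLE hk l
        swap
        · exact fix z (by have := Fin.val_ne_of_ne hz; simp only [Fin.val_castLE] at *; omega) h2
        subst hz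
        have hcl := hc.lt _ hl
        -- The target letter occurs at some `j` up to bar. Unless it already sits at `l`, its
        -- position violates the matching condition (`j < l`) or the emptiness of the arc (`j > l`),
        -- and a barred occurrence violates `hall`.
        obtain ⟨j, hj⟩ := exists_entry_of_lt w (c (Fin.castLE hk l)) hcl
        by_contra hne
        have hbar := hall j (Or.inl (Nat.zero_le _))
        have hj2 := entry_lt w j
        rcases lt_trichotomy j (Fin.castLE hk l) with hjl | hjl | hjl
        · have := cond j _ hjl hl
          have := hc.lt j (lt_trans hjl hl)
          simp only [HalfArc, Arc] at *
          omega
        · subst hjl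
          omega
        · have := hw j hjl
          simp only [HalfArc, Arc] at *
          omega

/-- At index `k` no entries are prescribed yet. At index `0` every arc is a single point, so
distinctness of the targets makes the matching condition automatic. -/
theorem segment_gammaL {c : Fin n → ℕ} (hc : IsTarget k c) (hk : k ≤ n) :
    Segment (MovesToward k c) (ArcCondition k c) (gammaL hk).reverse
      (fun w => ∀ z : Fin n, z.val < k → entry w z = c z) := by
  rw [gammaL, List.reverse_flatMap]
  refine (Segment.flatMap_finRange_reverse k _ (MatchedFrom k c) fun l =>
    segment_gammaSegment hc hk l).congr (fun w => ?_) fun w => ?_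
  · exact ⟨fun h => ⟨h, fun z h1 h2 => absurd h2 (by omega)⟩, fun h => h.1⟩
  · refine ⟨fun h => ⟨fun i z hi hz => ?_, fun z _ hz => h z hz⟩,
      fun h z hz => h.2 z (Nat.zero_le _) hz⟩
    have h1 := hc.ne i z (lt_trans hi hz) hz hi.ne
    rw [h i (lt_trans hi hz)]
    simp only [Arc]
    omega

/-- The entries of a column, extended by zero. -/
def columnEntry (C : Fin k → Letter n) (j : Fin n) : ℕ :=
  if h : j.val < k then (C ⟨j, h⟩).val else 0

theorem columnEntry_castLE (hk : k ≤ n) (C : Fin k → Letter n) (j : Fin k) :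
    columnEntry C (Fin.castLE hk j) = (C j).val := by
  simp [columnEntry]

theorem isTarget_columnEntry (hk : k ≤ n) {C : Fin k → Letter n} (hC : IsColumn C) :
    IsTarget k (columnEntry C) := by
  have hlift (j : Fin n) (hj : j.val < k) : j = Fin.castLE hk ⟨j, hj⟩ := rfl
  have hne (i j : Fin k) (hij : i ≠ j) :
      (C i).val ≠ (C j).val ∧ (C i).val + (C j).val + 1 ≠ 2 * n := by
    have h1 : absIndex (C i) ≠ absIndex (C j) := fun h => hij (hC h)
    refine ⟨fun h => h1 (by rw [Fin.ext h]), fun h => h1 ?_⟩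
    rw [← absIndex_bar (C j)]
    congr 1
    apply Fin.ext
    rw [bar_val]
    omega
  refine ⟨fun j hj => ?_, fun i j hi hj hij => ?_, fun i j hi hj => ?_⟩
  · rw [hlift j hj, columnEntry_castLE]
    exact (C _).isLt
  · rw [hlift i hi, hlift j hj, columnEntry_castLE, columnEntry_castLE]
    exact (hne _ _ fun h => hij (Fin.ext (Fin.mk.inj h))).1
  · by_cases hij : i = j
    · subst hij
      omega
    · rw [hlift i hi, hlift j hj, columnEntry_castLE, columnEntry_castLE]
      exact (hne _ _ fun h => hij (Fin.ext (Fin.mk.inj h))).2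

theorem circLE_iff_arc (a x y : Letter n) : CircLE a x y ↔ Arc a y x := by
  rw [CircLE, Fin.le_def]
  have h (z : Letter n) : (z - a).val = if a.val ≤ z.val then z.val - a.val
      else 2 * n + z.val - a.val := by
    split_ifs with h
    · exact Fin.sub_val_of_le h
    · exact Fin.coe_sub_iff_lt.2 (by omega)
  rw [h, h, Arc]
  have := a.isLt
  have := x.isLt
  have := y.isLt
  split_ifs <;> omega

/-- The letters of the target column are distinct, so the excluded equality and the excluded strict
betweenness combine into a closed arc. -/
theorem columnCondition_iff (hk : k ≤ n) {C : Fin k → Letter n} (hC : IsColumn C)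
    (w : signedPerm n) :
    ColumnCondition C (initialColumn hk w) ↔ ArcCondition k (columnEntry C) w := by
  have key (i l : Fin k) (hil : i < l) :
      (¬ (initialColumn hk w i = C l) ∧ ¬ (CircLT (initialColumn hk w i) (initialColumn hk w i) (C l)
        ∧ CircLT (initialColumn hk w i) (C l) (C i))) ↔
      ¬ Arc (entry w (Fin.castLE hk i)) (columnEntry C (Fin.castLE hk i))
        (columnEntry C (Fin.castLE hk l)) := by
    have hne : C i ≠ C l := fun h => hil.ne (hC (by simp only [h]))
    have hne' := Fin.val_ne_of_ne hne
    have e : entry w (Fin.castLE hk i) = (initialColumn hk w i).val := rfl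
    rw [columnEntry_castLE, columnEntry_castLE, e]
    have hlt (a x y : Letter n) : CircLT a x y ↔ ¬ CircLE a y x := by
      rw [CircLT, CircLE, not_le]
    rw [hlt, hlt, circLE_iff_arc, circLE_iff_arc, Fin.ext_iff]
    simp only [Arc]
    omega
  constructor
  · intro h i z hiz hz
    exact (key ⟨i, lt_trans hiz hz⟩ ⟨z, hz⟩ hiz).1 (h _ _ hiz)
  · intro h i l hil
    exact (key i l hil).2 (h _ _ hil l.isLt)

theorem initialColumn_eq_iff (hk : k ≤ n) (C : Fin k → Letter n) (w : signedPerm n) :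
    initialColumn hk w = C ↔ ∀ z : Fin n, z.val < k → entry w z = columnEntry C z := by
  constructor
  · rintro rfl z hz
    exact (columnEntry_castLE hk (initialColumn hk w) ⟨z, hz⟩).symm
  · intro h
    funext j
    apply Fin.ext
    rw [← columnEntry_castLE hk C j]
    exact h (Fin.castLE hk j) j.isLt

/-- Steps are monotone relative to the current entry. The hypothesis `ha`, that this entry lies
between `a` and the target, is carried along to make them monotone relative to the fixed origin `a`.
-/
theorem isChain_circLE (hk : k ≤ n) (c : Fin n → ℕ) (i : Fin k) (a : Letter n)
    (l : List (signedPerm n)) (w : signedPerm n) (h : (w :: l).IsChain (MovesToward k c))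
    (ha : Arc a (c (Fin.castLE hk i)) (entry w (Fin.castLE hk i))) :
    ((w :: l).map fun x => initialColumn hk x i).IsChain (CircLE a) := by
  induction l generalizing w with
  | nil => simp
  | cons x l ih =>
    simp only [List.map_cons, List.isChain_cons_cons] at h ih ⊢
    have hx := h.1 (Fin.castLE hk i) i.isLt
    refine ⟨(circLE_iff_arc _ _ _).2 ?_, ih x h.2 ?_⟩
    · change Arc a (entry x (Fin.castLE hk i)) (entry w (Fin.castLE hk i))
      simp only [Arc] at *
      omega
    · simp only [Arc] at *
      omega

end Columns

end TypeC

theorem mainTheorem8 (n k : ℕ) (hk1 : 1 ≤ k) (hk : k ≤ n) (u : TypeC.signedPerm n)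
    (C' : Fin k → TypeC.Letter n) (hC' : TypeC.IsColumn C') :
    (TypeC.ColumnCondition C' (TypeC.initialColumn hk u) ↔
      ∃ v S, TypeC.IsPathToColumn hk u C' v S) ∧
    (∀ v S v₂ S₂, TypeC.IsPathToColumn hk u C' v S → TypeC.IsPathToColumn hk u C' v₂ S₂ →
      v = v₂ ∧ S = S₂) ∧
    (∀ v S, TypeC.IsPathToColumn hk u C' v S → ∀ i : Fin k,
      List.IsChain (TypeC.CircLE (TypeC.initialColumn hk u i))
        ((TypeC.pathVertices u S).map fun w => TypeC.initialColumn hk w i)) := by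
  have seg := TypeC.segment_gammaL (TypeC.isTarget_columnEntry hk hC') hk
  simp only [← TypeC.initialColumn_eq_iff hk] at seg
  rw [TypeC.columnCondition_iff hk hC']
  refine ⟨⟨fun h => ?_, ?_⟩, ?_, ?_⟩
  · obtain ⟨S, v, h1, h2, h3⟩ := seg.exists_path u h
    exact ⟨v, S, h1, h3, h2⟩
  · rintro ⟨v, S, h1, h2, h3⟩
    exact (seg.source u S v h1 h3 h2).1
  · rintro v S v₂ S₂ ⟨h1, h2, h3⟩ ⟨h4, h5, h6⟩
    obtain rfl := seg.unique u S v S₂ v₂ h1 h3 h2 h4 h6 h5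
    exact ⟨h1.end_unique h4, rfl⟩
  · rintro v S ⟨h1, h2, h3⟩ i
    refine TypeC.isChain_circLE hk _ i _ _ u (seg.source u S v h1 h3 h2).2 ?_
    change TypeC.Arc (TypeC.entry u (Fin.castLE hk i)) _ (TypeC.entry u (Fin.castLE hk i))
    simp only [TypeC.Arc]
    omega
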